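/- **Setting.** Let $\mathcal G$ be a simple, strongly connected directed graph with vertex set $\{1,\dots,n\}$, $n\ge 1$, and positive edge weights: $\mathcal A_{ij}>0$ is the weight of the edge $(i,j)$, $\mathcal A_{ij}=0$ if $(i,j)$ is not an edge. Let $L$ be its Laplacian, $L_{ii}=\sum_{j\ne i}\mathcal A_{ij}$ and $L_{ij}=-\mathcal A_{ij}$ for $i\neq j$, and let $\Sigma$ be the network system $\dot x=-Lx+Fu$, $y=Hx$ with $F\in\mathbb R^{n\times p}$, $H\in\mathbb R^{q\times n}$. Let $M$ be a diagonal matrix with positive diagonal such that $L_b=ML$ is the Laplacian of a balanced graph (every vertex has equal indegree and outdegree in the weights $M\mathcal A$), and put $F_b=MF$. Let $\{\mathcal C_1,\dots,\mathcal C_r\}$ be a partition of the vertices into nonempty clusters, with characteristic matrix $\Pi\in\{0,1\}^{n\times r}$, $\Pi_{ij}=1$ iff $i\in\mathcal C_j$. The quotient graph has vertices $1,\dots,r$ and an edge $(k,l)$, $k\ne l$, iff some vertex of $\mathcal C_k$ has an edge to some vertex of $\mathcal C_l$; let $m$ be its number of edges and $\hat{\mathcal B}\in\mathbb R^{r\times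 m}$ its incidence matrix ($+1$ where the edge leaves the vertex, $-1$ where it enters), and let $\hat{\mathcal B}_0$ be $\hat{\mathcal B}$ with the entries $-1$ replaced by $0$. Let $$\mathcal M=\{\mathrm{Diag}(\hat w)\mid \hat w\in\mathbb R^m,\ \hat w_k>0 \text{ for all } k,\ \hat{\mathcal B}\hat w=0\}.$$ For $\hat W\in\mathcal M$ put $\hat M=\Pi^\top M\Pi$, $\hat L_b=\hat{\mathcal B}_0\hat W\hat{\mathcal B}^\top$, $\hat F_b=\Pi^\top F_b$, $\hat L=\hat M^{-1}\hat L_b$, $\hat F=\hat M^{-1}\hat F_b$, $\hat H=H\Pi$. The reduced-order model $\hat\Sigma=\hat\Sigma(\hat W)$ is $\dot{\hat x}=-\hat L\hat x+\hat Fu$, $\hat y=\hat H\hat x$, and the error system has the transfer function $$G_e(s)=\begin{bmatrix}H&-\hat H\end{bmatrix}\left(sI+\begin{bmatrix}L&0\\0&\hat L\end{bmatrix}\right)^{-1}\begin{bmatrix}F\\\hat F\end{bmatrix},\qquad \|G_e\|_{\mathcal H_2}^2=\sup_{\sigma>0}\frac1{2\pi}\int_{-\infty}^{\infty}\|G_e(\sigma+i\omega)\|_F^2\,d\omega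 .$$ For $k\ge1$ let $S_k=\begin{bmatrix}-I_{k-1}\\ \mathbf 1_{k-1}^\top\end{bmatrix}\in\mathbb R^{k\times(k-1)}$, and let $S_n^+=(S_n^\top M^{-1}S_n)^{-1}S_n^\top M^{-1}$, $S_r^+=(S_r^\top\hat M^{-1}S_r)^{-1}S_r^\top\hat M^{-1}$, $$B_e=\begin{bmatrix}S_n^+F_b\\S_r^+\hat F_b\end{bmatrix},\quad C_e=\begin{bmatrix}HM^{-1}S_n&-\hat H\hat M^{-1}S_r\end{bmatrix},\quad \bar A=\begin{bmatrix}-S_n^+L_bM^{-1}S_n&0\\0&0\end{bmatrix},$$ $$E=\begin{bmatrix}0&0\\I_{r-1}&0\end{bmatrix},\quad \bar A_r=\bar A_r(\hat W)=\begin{bmatrix}0&-S_r^+\hat{\mathcal B}_0\hat W\hat{\mathcal B}^\top\hat M^{-1}S_r\\0&0\end{bmatrix},$$ where $\bar A$, $E$ and $\bar A_r$ are square of size $n+r-2$; the rows and columns of $\bar A$, the rows of $E$ and the columns of $\bar A_r$ are partitioned as $(n-1)+(r-1)$, the columns of $E$ and the rows of $\bar A_r$ as $(r-1)+(n-1)$.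 **Theorem 1.** For every $\gamma\in\mathbb R$ the following are equivalent. (a) There is a reduced-order model $\hat\Sigma(\hat W)$, $\hat W\in\mathcal M$, with $\|G_e\|_{\mathcal H_2}^2<\gamma$. (b) There are symmetric positive definite matrices $\hat Q\in\mathbb R^{(n+r-2)\times(n+r-2)}$ and $\hat R\in\mathbb R^{q\times q}$, a matrix $\hat W\in\mathcal M$ and a number $\hat\delta>0$ such that $$\begin{bmatrix}\hat Q\bar A+\bar A^\top\hat Q&\hat QB_e&\hat QE\\B_e^\top\hat Q&-\hat\delta I&0\\E^\top\hat Q&0&0\end{bmatrix}+\begin{bmatrix}-\bar A_r^\top\bar A_r&0&\bar A_r^\top\\0&0&0\\\bar A_r&0&-I\end{bmatrix}<0,\qquad\begin{bmatrix}\hat Q&\hat\delta C_e^\top\\\hat\delta C_e&\hat R\end{bmatrix}>0,\qquad \mathrm{tr}(\hat R)<\hat\gamma:=\hat\delta\gamma,$$ where $<0$ and $>0$ mean negative and positive definite. -/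

import Mathlib

open scoped ENNReal

noncomputable section

namespace NetRed

/-- A directed graph on `Fin n` given by its edge relation: `adj i j` says that there is an edge
directed from `i` to `j`. Its edge set. -/
abbrev Edge {n : ℕ} (adj : Fin n → Fin n → Prop) : Type :=
  {e : Fin n × Fin n // adj e.1 e.2}

instance {n : ℕ} (adj : Fin n → Fin n → Prop) : Fintype (Edge adj) :=
  Fintype.ofFinite _

/-- The incidence matrix of a (loop-free) directed graph: `+1` if the edge is directed from the
vertex, `-1` if it is directed to the vertex. -/
def incidence {n : ℕ} (adj : Fin n → Fin n → Prop) : Matrix (Fin n) (Edge adj) ℝ :=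
  Matrix.of fun i e => if e.1.1 = i then 1 else if e.1.2 = i then -1 else 0

/-- The incidence matrix with all entries `-1` replaced by `0`. -/
def incidence₀ {n : ℕ} (adj : Fin n → Fin n → Prop) : Matrix (Fin n) (Edge adj) ℝ :=
  (incidence adj).map fun x => if x = -1 then 0 else x

/-- The Laplacian matrix of a weighted directed graph with weighted adjacency matrix `A`. -/
def laplacian {n : ℕ} (A : Matrix (Fin n) (Fin n) ℝ) : Matrix (Fin n) (Fin n) ℝ :=
  Matrix.of fun i j => if i = j then ∑ k ∈ Finset.univ.erase i, A i k else -A i j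

/-- Every vertex has equal row sum and column sum in the weighted adjacency matrix
(equal in- and outdegree). -/
def IsBalanced {n : ℕ} (A : Matrix (Fin n) (Fin n) ℝ) : Prop :=
  ∀ i, ∑ j, A i j = ∑ j, A j i

/-- A diffusively coupled network system `x' = -L x + F u`, `y = H x` on a simple, weighted,
strongly connected directed graph with `n ≥ 1` vertices. The vertex pair `(i, j)` is an edge
iff `A i j > 0`, and `A i j` is then its weight. -/
structure Network (n p q : ℕ) where
  A : Matrix (Fin n) (Fin n) ℝ
  F : Matrix (Fin n) (Fin p) ℝ
  H : Matrix (Fin q) (Fin n) ℝ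
  nonempty : 0 < n
  nonneg : ∀ i j, 0 ≤ A i j
  loopless : ∀ i, A i i = 0
  stronglyConnected : ∀ i j, Relation.ReflTransGen (fun a b => 0 < A a b) i j

/-- The transfer function `s ↦ C (s I - A)⁻¹ B` of a real state-space realization. -/
def transfer {ι : Type} [Fintype ι] [DecidableEq ι] {p q : ℕ} (A : Matrix ι ι ℝ)
    (B : Matrix ι (Fin p) ℝ) (C : Matrix (Fin q) ι ℝ) (s : ℂ) : Matrix (Fin q) (Fin p) ℂ :=
  C.map Complex.ofReal * (s • (1 : Matrix ι ι ℂ) - A.map Complex.ofReal)⁻¹ * B.map Complex.ofReal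

/-- The squared `H₂` norm (Hardy space of the open right half-plane, Frobenius norm on values),
`sup_{σ > 0} (1 / 2π) ∫ ‖G(σ + iω)‖_F² dω`, with value `∞` if `G` is not in `H₂`. -/
def h2NormSq {p q : ℕ} (G : ℂ → Matrix (Fin q) (Fin p) ℂ) : ℝ≥0∞ :=
  ⨆ (σ : ℝ) (_ : 0 < σ), ENNReal.ofReal (1 / (2 * Real.pi)) *
    ∫⁻ ω : ℝ, ∑ i, ∑ j, ‖G ((σ : ℂ) + (ω : ℂ) * Complex.I) i j‖ₑ ^ 2

/-- The `n × (n - 1)` matrix `[-I; 1ᵀ]`. -/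
def S (n : ℕ) : Matrix (Fin n) (Fin (n - 1)) ℝ :=
  Matrix.of fun i j => if i.val = j.val then -1 else if i.val = n - 1 then 1 else 0

/-- The left inverse `(Sᵀ M⁻¹ S)⁻¹ Sᵀ M⁻¹` of `S n`. -/
def Splus {n : ℕ} (M : Matrix (Fin n) (Fin n) ℝ) : Matrix (Fin (n - 1)) (Fin n) ℝ :=
  ((S n).transpose * M⁻¹ * S n)⁻¹ * (S n).transpose * M⁻¹

/-- The characteristic matrix of the clustering whose clusters are the fibres of `c`. -/
def Pi {n r : ℕ} (c : Fin n → Fin r) : Matrix (Fin n) (Fin r) ℝ :=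
  Matrix.of fun i j => if c i = j then 1 else 0

/-- `M̂ = Πᵀ M Π`. -/
def Mhat {n r : ℕ} (c : Fin n → Fin r) (M : Matrix (Fin n) (Fin n) ℝ) :
    Matrix (Fin r) (Fin r) ℝ :=
  (Pi c).transpose * M * Pi c

/-- A `3 × 3` block matrix, row by row. -/
def block3 {a b c a' b' c' : Type}
    (X₁₁ : Matrix a a' ℝ) (X₁₂ : Matrix a b' ℝ) (X₁₃ : Matrix a c' ℝ)
    (X₂₁ : Matrix b a' ℝ) (X₂₂ : Matrix b b' ℝ) (X₂₃ : Matrix b c' ℝ)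
    (X₃₁ : Matrix c a' ℝ) (X₃₂ : Matrix c b' ℝ) (X₃₃ : Matrix c c' ℝ) :
    Matrix ((a ⊕ b) ⊕ c) ((a' ⊕ b') ⊕ c') ℝ :=
  Matrix.fromBlocks (Matrix.fromBlocks X₁₁ X₁₂ X₂₁ X₂₂) (Matrix.fromRows X₁₃ X₂₃)
    (Matrix.fromCols X₃₁ X₃₂) X₃₃

namespace Network

variable {n p q r : ℕ} (N : Network n p q) (c : Fin n → Fin r) (M : Matrix (Fin n) (Fin n) ℝ)

/-- The Laplacian `L` of the network. -/
def L : Matrix (Fin n) (Fin n) ℝ := laplacian N.A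

/-- The Laplacian `L_b = M L` of the balanced representation. -/
def Lb : Matrix (Fin n) (Fin n) ℝ := M * N.L

/-- The input matrix `F_b = M F` of the balanced representation. -/
def Fb : Matrix (Fin n) (Fin p) ℝ := M * N.F

/-- The edge relation of the quotient graph: an edge from cluster `k` to a different cluster `l`
iff some vertex of `k` has an edge to some vertex of `l`. -/
def quotAdj (k l : Fin r) : Prop :=
  k ≠ l ∧ ∃ i j, c i = k ∧ c j = l ∧ 0 < N.A i j

/-- The admissible weight matrices of the quotient graph: positive diagonal matrices `Diag ŵ`
with `B̂ ŵ = 0`. -/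
def weights : Set (Matrix (Edge (N.quotAdj c)) (Edge (N.quotAdj c)) ℝ) :=
  {W | ∃ w : Edge (N.quotAdj c) → ℝ, (∀ e, 0 < w e) ∧
    (incidence (N.quotAdj c)).mulVec w = 0 ∧ W = Matrix.diagonal w}

/-- `L̂_b(Ŵ) = B̂₀ Ŵ B̂ᵀ`. -/
def LbHat (W : Matrix (Edge (N.quotAdj c)) (Edge (N.quotAdj c)) ℝ) : Matrix (Fin r) (Fin r) ℝ :=
  incidence₀ (N.quotAdj c) * W * (incidence (N.quotAdj c)).transpose

/-- `F̂_b = Πᵀ F_b`. -/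
def FbHat : Matrix (Fin r) (Fin p) ℝ := (Pi c).transpose * N.Fb M

/-- `L̂(Ŵ) = M̂⁻¹ L̂_b(Ŵ)`. -/
def LHat (W : Matrix (Edge (N.quotAdj c)) (Edge (N.quotAdj c)) ℝ) : Matrix (Fin r) (Fin r) ℝ :=
  (Mhat c M)⁻¹ * N.LbHat c W

/-- `F̂ = M̂⁻¹ F̂_b`. -/
def FHat : Matrix (Fin r) (Fin p) ℝ := (Mhat c M)⁻¹ * N.FbHat c M

/-- `Ĥ = H Π`. -/
def HHat : Matrix (Fin q) (Fin r) ℝ := N.H * Pi c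

/-- The transfer function `G_e` of the error system: the network minus the reduced model
`x̂' = -L̂(Ŵ) x̂ + F̂ u`, `ŷ = Ĥ x̂`. -/
def errorTransfer (W : Matrix (Edge (N.quotAdj c)) (Edge (N.quotAdj c)) ℝ) :
    ℂ → Matrix (Fin q) (Fin p) ℂ :=
  transfer (-Matrix.fromBlocks N.L 0 0 (N.LHat c M W)) (Matrix.fromRows N.F (N.FHat c M))
    (Matrix.fromCols N.H (-N.HHat c))

/-- `B_e = [S_n⁺ F_b; S_r⁺ F̂_b]`. -/
def Be : Matrix (Fin (n - 1) ⊕ Fin (r - 1)) (Fin p) ℝ :=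
  Matrix.fromRows (Splus M * N.Fb M) (Splus (Mhat c M) * N.FbHat c M)

/-- `C_e = [H M⁻¹ S_n, -Ĥ M̂⁻¹ S_r]`. -/
def Ce : Matrix (Fin q) (Fin (n - 1) ⊕ Fin (r - 1)) ℝ :=
  Matrix.fromCols (N.H * M⁻¹ * S n) (-(N.HHat c * (Mhat c M)⁻¹ * S r))

/-- `Ā = [-S_n⁺ L_b M⁻¹ S_n, 0; 0, 0]`. -/
def Abar : Matrix (Fin (n - 1) ⊕ Fin (r - 1)) (Fin (n - 1) ⊕ Fin (r - 1)) ℝ :=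
  Matrix.fromBlocks (-(Splus M * N.Lb M * M⁻¹ * S n)) 0 0 0

/-- `Ā_r = [0, -S_r⁺ B̂₀ Ŵ B̂ᵀ M̂⁻¹ S_r; 0, 0]`. -/
def Abarr (W : Matrix (Edge (N.quotAdj c)) (Edge (N.quotAdj c)) ℝ) :
    Matrix (Fin (r - 1) ⊕ Fin (n - 1)) (Fin (n - 1) ⊕ Fin (r - 1)) ℝ :=
  Matrix.fromBlocks 0
    (-(Splus (Mhat c M) * (incidence₀ (N.quotAdj c) * W * (incidence (N.quotAdj c)).transpose) *
      (Mhat c M)⁻¹ * S r)) 0 0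

end Network

/-- `E = [0, 0; I, 0]`. -/
def E (n r : ℕ) : Matrix (Fin (n - 1) ⊕ Fin (r - 1)) (Fin (r - 1) ⊕ Fin (n - 1)) ℝ :=
  Matrix.fromBlocks 0 0 1 0

end NetRed

end

/-! Both Laplacians annihilate constants, so both systems may have a pole at 0. For the network its
residue is H 1 1ᵀ M F / (1ᵀ M 1), and the reduced model has the same one, because Π 1 = 1 and Πᵀ M Π
has the same total weight as M. The poles therefore cancel in G_e (`Network.errorTransfer_eq`),
leaving the block diagonal `Network.errorMatrix` on the disagreement spaces. It is stable: a
balanced Laplacian has the Dirichlet form ½ ∑ w (y_i - y_j)², which strong connectivity makes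
positive on nonconstant vectors.

For stable A the squared H₂ norm is tr(C X Cᵀ), where A X + X Aᵀ = -B Bᵀ. This is proved in the
frequency domain, by Cauchy's theorem for resolvents (`integral_hermForm_resolventRow`). A strict
bound leaves room for a perturbation, so the squared norm is below γ iff some X > 0 and δ > 0
satisfy A X + X Aᵀ + B Bᵀ + δ E Eᵀ < 0 and tr(C X Cᵀ) < γ (`h2NormSq_transfer_lt_iff`).

With Q = δ X⁻¹, Schur complements turn this into the matrix inequalities
(`exists_lmi_iff_exists_lyapunov`). Write K for Ā_r, so that A = Ā + E K. Eliminating the block -I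
completes a square: -KᵀK + (Q E + Kᵀ)(EᵀQ + K) = Q E K + KᵀEᵀQ + Q E EᵀQ. Products of Q with K are
thus avoided at the price of Q E EᵀQ, which in terms of X is δ E Eᵀ and is harmless since δ may be
small. -/

noncomputable section

namespace NetRed

/-! ### Contour integrals of resolvents -/

section Contour
open Complex Filter Topology Bornology MeasureTheory Asymptotics Set

variable {F : Type*} [NormedAddCommGroup F] [NormedSpace ℂ F] [CompleteSpace F]

omit [CompleteSpace F] in
/-- The integral along the imaginary axis of a function holomorphic on the closed right half-plane
that decays quadratically vanishes. -/
lemma integral_imaginary_axis_eq_zero {f : ℂ → F}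
    (hf : ∀ s : ℂ, 0 ≤ s.re → DifferentiableAt ℂ f s)
    (hO : f =O[cobounded ℂ] fun z => z⁻¹ * z⁻¹) :
    Integrable (fun ω : ℝ => f (ω * I)) ∧ ∫ ω : ℝ, f (ω * I) = 0 := by
  have hcont : Continuous fun ω : ℝ => f (ω * I) := by
    rw [continuous_iff_continuousAt]
    intro ω
    have h1 : ContinuousAt f (ω * I) := (hf _ (by simp)).continuousAt
    have h2 : Continuous fun ω : ℝ => (ω : ℂ) * I := by fun_prop
    exact ContinuousAt.comp (f := fun ω : ℝ => (ω : ℂ) * I) h1 h2.continuousAt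
  obtain ⟨K, hK⟩ := hO.bound
  obtain ⟨R, -, hR⟩ := (hasBasis_cobounded_norm (E := ℂ)).eventually_iff.1 hK
  have hbd : ∀ z : ℂ, R ≤ ‖z‖ → ‖f z‖ ≤ K * (‖z‖⁻¹ * ‖z‖⁻¹) := fun z hz => by
    simpa using hR (by simpa using hz)
  have hint : Integrable (fun ω : ℝ => f (ω * I)) := by
    refine (hcont.locallyIntegrable).integrable_of_isBigO_cocompact (g := fun ω : ℝ => (1 + ω ^ 2)⁻¹)
      ?_ (integrable_inv_one_add_sq.integrableAtFilter _)
    rw [← Metric.cobounded_eq_cocompact]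
    refine IsBigO.of_bound (2 * |K|) ?_
    filter_upwards [(hasBasis_cobounded_norm (E := ℝ)).mem_of_mem (i := max R 1) trivial] with ω hω
    have hω : max R 1 ≤ |ω| := by simpa using hω
    have h1 : 1 ≤ |ω| := (le_max_right _ _).trans hω
    have h2 := hbd (ω * I) (by simpa using (le_max_left _ _).trans hω)
    have h3 : 1 ≤ ω ^ 2 := by rw [← sq_abs]; nlinarith
    have hn : ‖(ω : ℂ) * I‖ = |ω| := by simp
    rw [hn, ← mul_inv, ← sq, sq_abs] at h2
    have h4 : ‖((1 : ℝ) + ω ^ 2)⁻¹‖ = (1 + ω ^ 2)⁻¹ := by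
      rw [Real.norm_of_nonneg (by positivity)]
    rw [h4]
    have h5 : (ω ^ 2)⁻¹ ≤ 2 * (1 + ω ^ 2)⁻¹ := by
      rw [← div_eq_mul_inv, ← one_div, div_le_div_iff₀ (by positivity) (by positivity)]
      linarith
    calc ‖f (ω * I)‖ ≤ K * (ω ^ 2)⁻¹ := h2
      _ ≤ |K| * (ω ^ 2)⁻¹ := by gcongr; exact le_abs_self K
      _ ≤ |K| * (2 * (1 + ω ^ 2)⁻¹) := by gcongr
      _ = _ := by ring
  refine ⟨hint, ?_⟩
  have hlim : Tendsto (fun T : ℝ => ∫ ω in (-T)..T, f (ω * I)) atTop (𝓝 (∫ ω : ℝ, f (ω * I))) :=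
    intervalIntegral_tendsto_integral hint tendsto_neg_atTop_atBot tendsto_id
  refine tendsto_nhds_unique hlim ?_
  -- Cauchy's theorem on [0, T] × [-T, T]: the three sides off the imaginary axis have total length
  -- 4T, and there |f| ≤ |K| T⁻².
  have hz : Tendsto (fun T : ℝ => 4 * |K| * T⁻¹) atTop (𝓝 0) := by
    simpa using tendsto_inv_atTop_zero.const_mul (4 * |K|)
  refine squeeze_zero_norm' ?_ hz
  filter_upwards [eventually_ge_atTop (max R 1)] with T hT
  have hT0 : 0 < T := lt_of_lt_of_le one_pos ((le_max_right _ _).trans hT)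
  have hRT : R ≤ T := (le_max_left _ _).trans hT
  have hfar : ∀ z : ℂ, T ≤ ‖z‖ → ‖f z‖ ≤ |K| * (T⁻¹ * T⁻¹) := fun z hz => by
    refine (hbd z (hRT.trans hz)).trans ?_
    gcongr
    exact le_abs_self K
  have hrect := integral_boundary_rect_eq_zero_of_differentiableOn f (⟨0, -T⟩ : ℂ) (⟨T, T⟩ : ℂ) (by
    intro z hz
    rw [mem_reProdIm] at hz
    have : 0 ≤ z.re := by
      have := hz.1
      simp only [uIcc_of_le hT0.le] at this
      exact this.1
    exact (hf z this).differentiableWithinAt)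
  simp only [ofReal_zero, zero_add] at hrect
  have e : I • (∫ y : ℝ in (-T)..T, f (y * I)) =
      (∫ x : ℝ in (0 : ℝ)..T, f (x + (-T : ℝ) * I)) - (∫ x : ℝ in (0 : ℝ)..T, f (x + T * I)) +
      I • (∫ y : ℝ in (-T)..T, f (T + y * I)) := (sub_eq_zero.1 hrect).symm
  have n1 : ‖∫ x : ℝ in (0 : ℝ)..T, f (x + (-T : ℝ) * I)‖ ≤ |K| * (T⁻¹ * T⁻¹) * |T - 0| :=
    intervalIntegral.norm_integral_le_of_norm_le_const fun x _ => hfar _ (by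
      have := abs_im_le_norm (x + (-T : ℝ) * I)
      simpa [abs_of_pos hT0] using this)
  have n2 : ‖∫ x : ℝ in (0 : ℝ)..T, f (x + T * I)‖ ≤ |K| * (T⁻¹ * T⁻¹) * |T - 0| :=
    intervalIntegral.norm_integral_le_of_norm_le_const fun x _ => hfar _ (by
      have := abs_im_le_norm (x + T * I)
      simpa [abs_of_pos hT0] using this)
  have n3 : ‖∫ y : ℝ in (-T)..T, f (T + y * I)‖ ≤ |K| * (T⁻¹ * T⁻¹) * |T - -T| :=
    intervalIntegral.norm_integral_le_of_norm_le_const fun y _ => hfar _ (by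
      have := abs_re_le_norm (T + y * I)
      simpa [abs_of_pos hT0] using this)
  have e' : ‖∫ y : ℝ in (-T)..T, f (y * I)‖ = ‖I • ∫ y : ℝ in (-T)..T, f (y * I)‖ := by
    rw [norm_smul, norm_I, one_mul]
  rw [e', e]
  refine (norm_add_le _ _).trans ((add_le_add_left (norm_sub_le _ _) _).trans ?_)
  rw [norm_smul, norm_I, one_mul]
  rw [sub_zero, abs_of_pos hT0] at n1 n2
  rw [sub_neg_eq_add, abs_of_pos (add_pos hT0 hT0)] at n3
  refine (add_le_add (add_le_add n1 n2) n3).trans (le_of_eq ?_)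
  field_simp
  ring

variable {𝔸 : Type*} [NormedRing 𝔸] [NormedAlgebra ℂ 𝔸] [CompleteSpace 𝔸]

/-- A single resolvent is only O(1/s), but by the resolvent identity the difference is the product
of both resolvents around a - b, hence O(1/s²). -/
lemma integral_resolvent_sub_eq_zero {a b : 𝔸}
    (ha : ∀ s : ℂ, 0 ≤ s.re → s ∈ resolventSet ℂ a)
    (hb : ∀ s : ℂ, 0 ≤ s.re → s ∈ resolventSet ℂ b) :
    Integrable (fun ω : ℝ => resolvent a (ω * I) - resolvent b (ω * I)) ∧
      ∫ ω : ℝ, (resolvent a (ω * I) - resolvent b (ω * I)) = 0 := by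
  refine integral_imaginary_axis_eq_zero (f := fun s => resolvent a s - resolvent b s) ?_ ?_
  · intro s hs
    exact (spectrum.hasDerivAt_resolvent_const_left (ha s hs)).differentiableAt.sub
      (spectrum.hasDerivAt_resolvent_const_left (hb s hs)).differentiableAt
  · have h : (fun s : ℂ => resolvent a s - resolvent b s) =ᶠ[cobounded ℂ]
        fun s => resolvent a s * (a - b) * resolvent b s := by
      filter_upwards [spectrum.eventually_isUnit_resolvent a,
        spectrum.eventually_isUnit_resolvent b] with s h1 h2
      exact spectrum.resolvent_sub_resolvent (spectrum.isUnit_resolvent.2 h1)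
        (spectrum.isUnit_resolvent.2 h2)
    refine h.trans_isBigO ?_
    have h1 := ((spectrum.resolvent_isBigO_inv (𝕜 := ℂ) a).mul
      (isBigO_const_const (a - b) (one_ne_zero (α := ℂ)) (cobounded ℂ))).mul
      (spectrum.resolvent_isBigO_inv (𝕜 := ℂ) b)
    simpa using h1

end Contour

/-! ### Stable matrices and Lyapunov equations on the imaginary axis -/

section Stable
open Matrix Complex

variable {ι : Type} [Fintype ι]

/-- `A` admits a quadratic Lyapunov function that strictly decreases along `x' = A x`. -/
def IsLyapunovStable (A : Matrix ι ι ℝ) : Prop :=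
  ∃ P : Matrix ι ι ℝ, P.PosDef ∧ ∀ x, x ≠ 0 → x ⬝ᵥ (P *ᵥ (A *ᵥ x)) < 0

lemma dotProduct_mulVec_comm {X : Matrix ι ι ℝ} (hX : Xᵀ = X) (x y : ι → ℝ) :
    x ⬝ᵥ (X *ᵥ y) = y ⬝ᵥ (X *ᵥ x) := by
  rw [dotProduct_mulVec, ← mulVec_transpose, hX, dotProduct_comm]

omit [Fintype ι] in
lemma transpose_eq_of_posDef {X : Matrix ι ι ℝ} (hX : X.PosDef) : Xᵀ = X := by
  simpa using hX.1.eq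

lemma posDef_iff_real {X : Matrix ι ι ℝ} :
    X.PosDef ↔ Xᵀ = X ∧ ∀ x, x ≠ 0 → 0 < x ⬝ᵥ (X *ᵥ x) := by
  rw [posDef_iff_dotProduct_mulVec]
  simp [IsHermitian]

lemma posSemidef_iff_real {X : Matrix ι ι ℝ} :
    X.PosSemidef ↔ Xᵀ = X ∧ ∀ x, 0 ≤ x ⬝ᵥ (X *ᵥ x) := by
  rw [posSemidef_iff_dotProduct_mulVec]
  simp [IsHermitian]

/-- The Hermitian form `w Q w*` of a real symmetric matrix, through real and imaginary parts. -/
def hermForm (Q : Matrix ι ι ℝ) (w : ι → ℂ) : ℝ :=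
  (re ∘ w) ⬝ᵥ (Q *ᵥ (re ∘ w)) + (im ∘ w) ⬝ᵥ (Q *ᵥ (im ∘ w))

lemma hermForm_add (Q R : Matrix ι ι ℝ) (w : ι → ℂ) :
    hermForm (Q + R) w = hermForm Q w + hermForm R w := by
  simp only [hermForm, add_mulVec, dotProduct_add]
  ring

lemma hermForm_nonneg {Q : Matrix ι ι ℝ} (hQ : Q.PosSemidef) (w : ι → ℂ) : 0 ≤ hermForm Q w :=
  add_nonneg ((posSemidef_iff_real.1 hQ).2 _) ((posSemidef_iff_real.1 hQ).2 _)

lemma re_mulVec_map (A : Matrix ι ι ℝ) (v : ι → ℂ) :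
    re ∘ (A.map ofReal *ᵥ v) = A *ᵥ (re ∘ v) := by
  ext i; simp [mulVec, dotProduct]

lemma im_mulVec_map (A : Matrix ι ι ℝ) (v : ι → ℂ) :
    im ∘ (A.map ofReal *ᵥ v) = A *ᵥ (im ∘ v) := by
  ext i; simp [mulVec, dotProduct]

lemma sum_norm_sq_eq_hermForm {p : ℕ} (B : Matrix ι (Fin p) ℝ) (w : ι → ℂ) :
    ∑ j, ‖(w ᵥ* B.map ofReal) j‖ ^ 2 = hermForm (B * Bᵀ) w := by
  have h : ∀ x : ι → ℝ, x ⬝ᵥ ((B * Bᵀ) *ᵥ x) = ∑ j, (x ᵥ* B) j ^ 2 := fun x => by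
    rw [← mulVec_mulVec, dotProduct_mulVec, mulVec_transpose]
    simp [dotProduct, sq]
  rw [hermForm, h, h, ← Finset.sum_add_distrib]
  refine Finset.sum_congr rfl fun j _ => ?_
  rw [← normSq_eq_norm_sq, normSq_apply]
  simp [vecMul, dotProduct, sq]

variable [DecidableEq ι]

/-- Shifting by σ moves the line Re s = σ to the imaginary axis. -/
lemma IsLyapunovStable.sub_smul {A : Matrix ι ι ℝ} (hA : IsLyapunovStable A) {σ : ℝ} (hσ : 0 ≤ σ) :
    IsLyapunovStable (A - σ • 1) := by
  obtain ⟨P, hP, h⟩ := hA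
  refine ⟨P, hP, fun x hx => ?_⟩
  have h1 := h x hx
  have h2 := (posDef_iff_real.1 hP).2 x hx
  simp only [sub_mulVec, smul_mulVec, one_mulVec, mulVec_sub, mulVec_smul, dotProduct_sub,
    dotProduct_smul, smul_eq_mul]
  nlinarith

/-- An eigenvector v for s would give Re(v* P A v) = Re s · v* P v ≥ 0, against the strict decrease
of P on the real and imaginary parts of v. -/
lemma IsLyapunovStable.isUnit_det {A : Matrix ι ι ℝ} (hA : IsLyapunovStable A) {s : ℂ}
    (hs : 0 ≤ s.re) : IsUnit (s • (1 : Matrix ι ι ℂ) - A.map ofReal).det := by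
  obtain ⟨P, hP, h⟩ := hA
  rw [isUnit_iff_ne_zero]
  intro h0
  obtain ⟨v, hv, hv0⟩ := exists_mulVec_eq_zero_iff.2 h0
  rw [sub_mulVec, smul_mulVec, one_mulVec, sub_eq_zero] at hv0
  have hx : A *ᵥ (re ∘ v) = s.re • (re ∘ v) - s.im • (im ∘ v) := by
    rw [← re_mulVec_map, ← hv0]; ext i; simp
  have hy : A *ᵥ (im ∘ v) = s.re • (im ∘ v) + s.im • (re ∘ v) := by
    rw [← im_mulVec_map, ← hv0]; ext i; simp
  have hP' := posDef_iff_real.1 hP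
  have key : (re ∘ v) ⬝ᵥ (P *ᵥ (A *ᵥ (re ∘ v))) + (im ∘ v) ⬝ᵥ (P *ᵥ (A *ᵥ (im ∘ v))) =
      s.re * ((re ∘ v) ⬝ᵥ (P *ᵥ (re ∘ v)) + (im ∘ v) ⬝ᵥ (P *ᵥ (im ∘ v))) := by
    rw [hx, hy]
    simp only [mulVec_sub, mulVec_add, mulVec_smul, dotProduct_sub, dotProduct_add,
      dotProduct_smul, smul_eq_mul]
    rw [dotProduct_mulVec_comm hP'.1 (im ∘ v) (re ∘ v)]
    ring
  have hsum : 0 ≤ s.re * ((re ∘ v) ⬝ᵥ (P *ᵥ (re ∘ v)) + (im ∘ v) ⬝ᵥ (P *ᵥ (im ∘ v))) :=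
    mul_nonneg hs (hermForm_nonneg hP.posSemidef v)
  have hle : ∀ x, x ⬝ᵥ (P *ᵥ (A *ᵥ x)) ≤ 0 := fun x => by
    by_cases hx : x = 0
    · simp [hx]
    · exact (h x hx).le
  by_cases hre : re ∘ v = 0
  · have him : im ∘ v ≠ 0 := fun him => hv (funext fun i =>
      Complex.ext (congrFun hre i) (congrFun him i))
    linarith [h _ him, hle (re ∘ v)]
  · linarith [h _ hre, hle (im ∘ v)]

attribute [local instance] Matrix.linftyOpNormedRing Matrix.linftyOpNormedAlgebra

lemma resolvent_matrix_eq (a : Matrix ι ι ℂ) (s : ℂ) :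
    resolvent a s = (s • (1 : Matrix ι ι ℂ) - a)⁻¹ := by
  rw [resolvent, Algebra.algebraMap_eq_smul_one, nonsing_inv_eq_ringInverse]

lemma IsLyapunovStable.mem_resolventSet {A : Matrix ι ι ℝ} (hA : IsLyapunovStable A) {s : ℂ}
    (hs : 0 ≤ s.re) : s ∈ resolventSet ℂ (A.map ofReal) := by
  rw [spectrum.mem_resolventSet_iff, Algebra.algebraMap_eq_smul_one]
  exact (isUnit_iff_isUnit_det _).2 (hA.isUnit_det hs)

/-- The reference matrix for the comparison of resolvents: its resolvent is explicit. -/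
lemma isLyapunovStable_neg_one : IsLyapunovStable (-1 : Matrix ι ι ℝ) := by
  refine ⟨1, PosDef.one, fun x hx => ?_⟩
  have := (posDef_iff_real.1 (PosDef.one (n := ι) (R := ℝ))).2 x hx
  simpa [neg_mulVec] using this

lemma continuousAt_resolvent_inv {A : Matrix ι ι ℝ} (hA : IsLyapunovStable A) {s : ℂ}
    (hs : 0 ≤ s.re) :
    ContinuousAt (fun z : ℂ => (z • (1 : Matrix ι ι ℂ) - A.map ofReal)⁻¹) s := by
  simp_rw [← resolvent_matrix_eq]
  exact (spectrum.hasDerivAt_resolvent_const_left (hA.mem_resolventSet hs)).continuousAt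

/-- The principal value integral of the resolvent of a stable matrix along the imaginary axis. -/
lemma integral_re_resolvent {A : Matrix ι ι ℝ} (hA : IsLyapunovStable A) (v b : ι → ℝ) :
    MeasureTheory.Integrable (fun ω : ℝ => ((ofReal ∘ v) ⬝ᵥ
      ((((ω : ℂ) * I) • (1 : Matrix ι ι ℂ) - A.map ofReal)⁻¹ *ᵥ (ofReal ∘ b))).re) ∧
    ∫ ω : ℝ, ((ofReal ∘ v) ⬝ᵥ
      ((((ω : ℂ) * I) • (1 : Matrix ι ι ℂ) - A.map ofReal)⁻¹ *ᵥ (ofReal ∘ b))).re =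
      Real.pi * (v ⬝ᵥ b) := by
  obtain ⟨h1, h2⟩ := integral_resolvent_sub_eq_zero
    (a := A.map ofReal) (b := (-1 : Matrix ι ι ℝ).map ofReal)
    (fun s hs => hA.mem_resolventSet hs) (fun s hs => isLyapunovStable_neg_one.mem_resolventSet hs)
  let φ : Matrix ι ι ℂ →ₗ[ℝ] ℝ :=
    { toFun := fun M => ((ofReal ∘ v) ⬝ᵥ (M *ᵥ (ofReal ∘ b))).re
      map_add' := fun M N => by simp [add_mulVec]
      map_smul' := fun c M => by simp [smul_mulVec] }
  let Φ : Matrix ι ι ℂ →L[ℝ] ℝ := φ.toContinuousLinearMap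
  have h3 : MeasureTheory.Integrable (fun ω : ℝ => φ (resolvent (A.map ofReal) ((ω : ℂ) * I) -
      resolvent ((-1 : Matrix ι ι ℝ).map ofReal) ((ω : ℂ) * I))) := Φ.integrable_comp h1
  have h4 : ∫ ω : ℝ, φ (resolvent (A.map ofReal) ((ω : ℂ) * I) -
      resolvent ((-1 : Matrix ι ι ℝ).map ofReal) ((ω : ℂ) * I)) = 0 := by
    refine (Φ.integral_comp_comm h1).trans ?_
    rw [h2]
    exact map_zero φ
  have hone : ∀ ω : ℝ, resolvent ((-1 : Matrix ι ι ℝ).map ofReal) ((ω : ℂ) * I) =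
      (1 + ω * I : ℂ)⁻¹ • (1 : Matrix ι ι ℂ) := fun ω => by
    rw [resolvent_matrix_eq]
    apply inv_eq_right_inv
    have hne : (1 + ω * I : ℂ) ≠ 0 := fun h => by simpa using congrArg re h
    have : (-1 : Matrix ι ι ℝ).map ofReal = (-1 : Matrix ι ι ℂ) := by
      rw [Matrix.map_neg _ (by simp), Matrix.map_one _ (by simp) (by simp)]
    have e : ((ω : ℂ) * I) • (1 : Matrix ι ι ℂ) + 1 = (1 + ω * I : ℂ) • 1 := by
      rw [add_smul, one_smul, add_comm]
    rw [this, sub_neg_eq_add, e, smul_mul_smul_comm, mul_inv_cancel₀ hne, one_smul, mul_one]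
  -- Taking real parts leaves Re (1 + iω)⁻¹ = (1 + ω²)⁻¹ from the reference resolvent: integrable,
  -- with integral π.
  have hφ : ∀ ω : ℝ, φ (resolvent (A.map ofReal) ((ω : ℂ) * I) -
      resolvent ((-1 : Matrix ι ι ℝ).map ofReal) ((ω : ℂ) * I)) =
      ((ofReal ∘ v) ⬝ᵥ
        ((((ω : ℂ) * I) • (1 : Matrix ι ι ℂ) - A.map ofReal)⁻¹ *ᵥ (ofReal ∘ b))).re -
      (v ⬝ᵥ b) * (1 + ω ^ 2)⁻¹ := fun ω => by
    have e : φ (resolvent ((-1 : Matrix ι ι ℝ).map ofReal) ((ω : ℂ) * I)) =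
        (v ⬝ᵥ b) * (1 + ω ^ 2)⁻¹ := by
      rw [hone]
      change ((ofReal ∘ v) ⬝ᵥ (((1 + ω * I : ℂ)⁻¹ • (1 : Matrix ι ι ℂ)) *ᵥ (ofReal ∘ b))).re = _
      have : (ofReal ∘ v) ⬝ᵥ (ofReal ∘ b) = ((v ⬝ᵥ b : ℝ) : ℂ) := by simp [dotProduct]
      rw [smul_mulVec, one_mulVec, dotProduct_smul, this, smul_eq_mul, re_mul_ofReal, inv_re,
        normSq_apply]
      simp
      ring
    rw [map_sub, e]
    congr 1
    rw [resolvent_matrix_eq]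
    rfl
  simp only [hφ] at h3 h4
  have h5 := integrable_inv_one_add_sq.const_mul (v ⬝ᵥ b)
  have h6 := h3.add h5
  have h7 : MeasureTheory.Integrable (fun ω : ℝ => ((ofReal ∘ v) ⬝ᵥ
      ((((ω : ℂ) * I) • (1 : Matrix ι ι ℂ) - A.map ofReal)⁻¹ *ᵥ (ofReal ∘ b))).re) := by
    refine h6.congr (Filter.Eventually.of_forall fun ω => ?_)
    simp
  refine ⟨h7, ?_⟩
  rw [MeasureTheory.integral_sub h7 h5, MeasureTheory.integral_const_mul,
    integral_univ_inv_one_add_sq, sub_eq_zero] at h4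
  rw [h4, mul_comm]

/-- The row `v (s I - A)⁻¹`. -/
def resolventRow (A : Matrix ι ι ℝ) (v : ι → ℝ) (s : ℂ) : ι → ℂ :=
  (ofReal ∘ v) ᵥ* (s • (1 : Matrix ι ι ℂ) - A.map ofReal)⁻¹

lemma continuousAt_resolventRow {A : Matrix ι ι ℝ} (hA : IsLyapunovStable A) (v : ι → ℝ) {s : ℂ}
    (hs : 0 ≤ s.re) : ContinuousAt (resolventRow A v) s := by
  have h : Continuous fun M : Matrix ι ι ℂ => (ofReal ∘ v) ᵥ* M :=
    Continuous.matrix_vecMul continuous_const continuous_id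
  exact h.continuousAt.comp (continuousAt_resolvent_inv hA hs)

omit [DecidableEq ι] in
lemma continuous_hermForm (Q : Matrix ι ι ℝ) : Continuous (hermForm Q) := by
  unfold hermForm
  have h1 : Continuous fun w : ι → ℂ => re ∘ w :=
    continuous_pi fun i => continuous_re.comp (continuous_apply i)
  have h2 : Continuous fun w : ι → ℂ => im ∘ w :=
    continuous_pi fun i => continuous_im.comp (continuous_apply i)
  have h3 : Continuous fun x : ι → ℝ => x ⬝ᵥ (Q *ᵥ x) :=
    Continuous.dotProduct continuous_id (Continuous.matrix_mulVec continuous_const continuous_id)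
  exact (h3.comp h1).add (h3.comp h2)

lemma resolventRow_add_real (A : Matrix ι ι ℝ) (v : ι → ℝ) (σ : ℝ) (s : ℂ) :
    resolventRow A v (σ + s) = resolventRow (A - σ • 1) v s := by
  unfold resolventRow
  congr 2
  ext i j
  by_cases h : i = j
  · simp [h, add_comm, sub_eq_add_neg, add_assoc]
  · simp [h]

/-- On the imaginary axis, the integral of `v (iω - A)⁻¹ Q (iω - A)⁻* vᵀ` is given by the solution
of the Lyapunov equation. -/
lemma integral_hermForm_resolventRow {A X Q : Matrix ι ι ℝ} (hA : IsLyapunovStable A)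
    (hX : Xᵀ = X) (hL : A * X + X * Aᵀ = -Q) (v : ι → ℝ) :
    MeasureTheory.Integrable (fun ω : ℝ => hermForm Q (resolventRow A v (ω * I))) ∧
    ∫ ω : ℝ, hermForm Q (resolventRow A v (ω * I)) = 2 * Real.pi * (v ⬝ᵥ (X *ᵥ v)) := by
  have hQ : ∀ x : ι → ℝ, x ⬝ᵥ (Q *ᵥ x) = -2 * ((x ᵥ* A) ⬝ᵥ (X *ᵥ x)) := fun x => by
    have : Q = -(A * X + X * Aᵀ) := by rw [hL, neg_neg]
    have h1 : x ⬝ᵥ ((A * X) *ᵥ x) = (x ᵥ* A) ⬝ᵥ (X *ᵥ x) := by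
      rw [← mulVec_mulVec, dotProduct_mulVec]
    have h2 : x ⬝ᵥ ((X * Aᵀ) *ᵥ x) = (x ᵥ* A) ⬝ᵥ (X *ᵥ x) := by
      rw [← mulVec_mulVec, dotProduct_mulVec_comm hX, mulVec_transpose]
    rw [this, neg_mulVec, dotProduct_neg, add_mulVec, dotProduct_add, h1, h2]
    ring
  -- With w (iω - A) = v, substitute w A = iω w - v into w Q w* = -2 Re (w A X w*); the iω term is
  -- purely imaginary because X is symmetric, so only v survives.
  have key : ∀ ω : ℝ, hermForm Q (resolventRow A v (ω * I)) = 2 * ((ofReal ∘ v) ⬝ᵥ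
      ((((ω : ℂ) * I) • (1 : Matrix ι ι ℂ) - A.map ofReal)⁻¹ *ᵥ (ofReal ∘ (X *ᵥ v)))).re := by
    intro ω
    have hw : resolventRow A v (ω * I) ᵥ* (((ω : ℂ) * I) • (1 : Matrix ι ι ℂ) - A.map ofReal) =
        ofReal ∘ v := by
      rw [resolventRow, vecMul_vecMul, nonsing_inv_mul _ (hA.isUnit_det (by simp)), vecMul_one]
    rw [dotProduct_mulVec, ← resolventRow]
    generalize resolventRow A v (ω * I) = w at hw ⊢
    rw [vecMul_sub, vecMul_smul, vecMul_one] at hw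
    have hx : (re ∘ w) ᵥ* A = -(ω • (im ∘ w)) - v := by
      ext i
      have := congrArg re (congrFun hw i)
      simp [vecMul, dotProduct] at this ⊢
      linarith
    have hy : (im ∘ w) ᵥ* A = ω • (re ∘ w) := by
      ext i
      have := congrArg im (congrFun hw i)
      simp [vecMul, dotProduct] at this ⊢
      linarith
    have hre : (w ⬝ᵥ (ofReal ∘ (X *ᵥ v))).re = v ⬝ᵥ (X *ᵥ (re ∘ w)) := by
      rw [dotProduct_mulVec_comm hX]
      simp [dotProduct]
    rw [hermForm, hQ, hQ, hx, hy, hre]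
    simp only [sub_dotProduct, neg_dotProduct, smul_dotProduct, smul_eq_mul]
    rw [dotProduct_mulVec_comm hX (im ∘ w) (re ∘ w)]
    ring
  obtain ⟨h1, h2⟩ := integral_re_resolvent hA v (X *ᵥ v)
  simp only [key]
  refine ⟨h1.const_mul 2, ?_⟩
  rw [MeasureTheory.integral_const_mul, h2]
  ring

end Stable

/-! ### The H₂ norm and the Lyapunov equation -/

section H2
open Matrix Complex MeasureTheory Filter Topology

variable {ι : Type} [Fintype ι] [DecidableEq ι] {p q : ℕ}

lemma lintegrand_transfer_eq (A : Matrix ι ι ℝ) (B : Matrix ι (Fin p) ℝ) (C : Matrix (Fin q) ι ℝ)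
    (s : ℂ) : ∑ i, ∑ j, ‖transfer A B C s i j‖ₑ ^ 2 =
      ENNReal.ofReal (∑ i, hermForm (B * Bᵀ) (resolventRow A (C i) s)) := by
  have h : ∀ i, ∑ j, ‖transfer A B C s i j‖ ^ 2 = hermForm (B * Bᵀ) (resolventRow A (C i) s) :=
    fun i => by
      rw [← sum_norm_sq_eq_hermForm]
      rfl
  simp_rw [← h]
  rw [ENNReal.ofReal_sum_of_nonneg fun i _ => Finset.sum_nonneg fun j _ => by positivity]
  refine Finset.sum_congr rfl fun i _ => ?_
  rw [ENNReal.ofReal_sum_of_nonneg fun j _ => by positivity]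
  refine Finset.sum_congr rfl fun j _ => ?_
  rw [← ofReal_norm, ENNReal.ofReal_pow (norm_nonneg _)]

omit [DecidableEq ι] in
lemma trace_mul_mul_transpose (C : Matrix (Fin q) ι ℝ) (X : Matrix ι ι ℝ) :
    (C * X * Cᵀ).trace = ∑ i, C i ⬝ᵥ (X *ᵥ C i) := by
  refine Finset.sum_congr rfl fun i _ => ?_
  rw [dotProduct_mulVec]
  rfl

omit [DecidableEq ι] in
lemma posSemidef_mul_transpose (B : Matrix ι (Fin p) ℝ) : (B * Bᵀ).PosSemidef := by
  simpa using posSemidef_self_mul_conjTranspose B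

/-- A solution of the Lyapunov inequality bounds the `H₂` norm. -/
lemma h2NormSq_transfer_le {A X : Matrix ι ι ℝ} {B : Matrix ι (Fin p) ℝ} {C : Matrix (Fin q) ι ℝ}
    (hA : IsLyapunovStable A) (hX : X.PosSemidef)
    (hL : (-(A * X + X * Aᵀ + B * Bᵀ)).PosSemidef) :
    h2NormSq (transfer A B C) ≤ ENNReal.ofReal (C * X * Cᵀ).trace := by
  refine iSup₂_le fun σ hσ => ?_
  have hAσ := hA.sub_smul hσ.le
  have hX' := (posSemidef_iff_real.1 hX).1
  -- On the line Re s = σ the same X solves the equation for A - σ exactly, with B Bᵀ enlarged by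
  -- the slack of the inequality and by 2σX. Both are positive semidefinite, so the integrand only
  -- grows.
  set D : Matrix ι ι ℝ := -(A * X + X * Aᵀ + B * Bᵀ) + (2 * σ) • X with hD
  have hDp : D.PosSemidef := hL.add (hX.smul (by positivity))
  have hLσ : (A - σ • 1) * X + X * (A - σ • 1)ᵀ = -(B * Bᵀ + D) := by
    rw [hD]
    simp only [sub_mul, smul_mul_assoc, one_mul, transpose_sub, transpose_smul, transpose_one,
      mul_sub, mul_smul_comm, mul_one, mul_smul, two_smul]
    abel
  have key := fun v => integral_hermForm_resolventRow hAσ hX' hLσ v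
  have hint : Integrable fun ω : ℝ =>
      ∑ i, hermForm (B * Bᵀ + D) (resolventRow (A - σ • 1) (C i) (ω * I)) :=
    integrable_finsetSum _ fun i _ => (key (C i)).1
  have hle : ∫⁻ ω : ℝ, ∑ i, ∑ j, ‖transfer A B C ((σ : ℂ) + (ω : ℂ) * I) i j‖ₑ ^ 2 ≤
      ENNReal.ofReal (2 * Real.pi * (C * X * Cᵀ).trace) := by
    have e : 2 * Real.pi * (C * X * Cᵀ).trace =
        ∫ ω : ℝ, ∑ i, hermForm (B * Bᵀ + D) (resolventRow (A - σ • 1) (C i) (ω * I)) := by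
      rw [integral_finsetSum _ fun i _ => (key (C i)).1, trace_mul_mul_transpose, Finset.mul_sum]
      exact Finset.sum_congr rfl fun i _ => (key (C i)).2.symm
    rw [e, ofReal_integral_eq_lintegral_ofReal hint (Eventually.of_forall fun ω =>
      Finset.sum_nonneg fun i _ => hermForm_nonneg ((posSemidef_mul_transpose B).add hDp) _)]
    refine lintegral_mono fun ω => ?_
    rw [lintegrand_transfer_eq]
    refine ENNReal.ofReal_le_ofReal (Finset.sum_le_sum fun i _ => ?_)
    rw [resolventRow_add_real, hermForm_add]
    exact le_add_of_nonneg_right (hermForm_nonneg hDp _)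
  refine (mul_le_mul_right hle _).trans (le_of_eq ?_)
  rw [← ENNReal.ofReal_mul (by positivity)]
  congr 1
  field_simp

/-- The solution of the Lyapunov equation gives a lower bound of the `H₂` norm. -/
lemma le_h2NormSq_transfer {A X : Matrix ι ι ℝ} {B : Matrix ι (Fin p) ℝ} {C : Matrix (Fin q) ι ℝ}
    (hA : IsLyapunovStable A) (hX : Xᵀ = X) (hL : A * X + X * Aᵀ = -(B * Bᵀ)) :
    ENNReal.ofReal (C * X * Cᵀ).trace ≤ h2NormSq (transfer A B C) := by
  have key := fun v => integral_hermForm_resolventRow hA hX hL v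
  set ψ : ℂ → ℝ≥0∞ := fun s =>
    ENNReal.ofReal (∑ i, hermForm (B * Bᵀ) (resolventRow A (C i) s)) with hψ
  have hψc : ∀ s : ℂ, 0 ≤ s.re → ContinuousAt ψ s := fun s hs => by
    refine ENNReal.continuous_ofReal.continuousAt.comp ?_
    refine tendsto_finsetSum _ fun i _ => ?_
    exact (continuous_hermForm (B * Bᵀ)).continuousAt.comp (continuousAt_resolventRow hA (C i) hs)
  have hint : Integrable fun ω : ℝ => ∑ i, hermForm (B * Bᵀ) (resolventRow A (C i) (ω * I)) :=
    integrable_finsetSum _ fun i _ => (key (C i)).1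
  have e : ENNReal.ofReal (2 * Real.pi * (C * X * Cᵀ).trace) = ∫⁻ ω : ℝ, ψ (ω * I) := by
    rw [hψ, ← ofReal_integral_eq_lintegral_ofReal hint (Eventually.of_forall fun ω =>
      Finset.sum_nonneg fun i _ => hermForm_nonneg (posSemidef_mul_transpose B) _),
      integral_finsetSum _ fun i _ => (key (C i)).1, trace_mul_mul_transpose, Finset.mul_sum]
    congr 1
    exact Finset.sum_congr rfl fun i _ => (key (C i)).2.symm
  have e2 : ENNReal.ofReal (C * X * Cᵀ).trace =
      ENNReal.ofReal (1 / (2 * Real.pi)) * ∫⁻ ω : ℝ, ψ (ω * I) := by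
    rw [← e, ← ENNReal.ofReal_mul (by positivity)]
    congr 1
    field_simp
  -- The norm sees only σ > 0, the Lyapunov equation computes the integral at σ = 0: let σ = 1/(k+1)
  -- tend to 0 and apply Fatou's lemma.
  have hσ : Tendsto (fun k : ℕ => ((1 : ℝ) / ((k : ℝ) + 1))) atTop (𝓝 0) :=
    tendsto_one_div_add_atTop_nhds_zero_nat
  set g : ℕ → ℝ → ℝ≥0∞ := fun k ω => ψ (((1 / ((k : ℝ) + 1) : ℝ) : ℂ) + ω * I) with hg
  have hgm : ∀ k, Measurable (g k) := fun k => by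
    refine Continuous.measurable (continuous_iff_continuousAt.2 fun ω => ?_)
    refine ContinuousAt.comp (f := fun ω : ℝ => (((1 / ((k : ℝ) + 1) : ℝ) : ℂ) + ω * I))
      (hψc _ ?_) (by fun_prop)
    simp only [add_re, ofReal_re, mul_re, I_re, I_im, ofReal_im, mul_zero, zero_mul, sub_zero,
      add_zero]
    positivity
  have hgl : ∀ ω : ℝ, liminf (fun k => g k ω) atTop = ψ (ω * I) := fun ω => by
    refine Tendsto.liminf_eq ?_
    refine (hψc (ω * I) (by simp)).tendsto.comp ?_
    have : Tendsto (fun k : ℕ => (((1 / ((k : ℝ) + 1) : ℝ) : ℂ) + ω * I)) atTop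
        (𝓝 (((0 : ℝ) : ℂ) + ω * I)) :=
      ((continuous_ofReal.tendsto 0).comp hσ).add_const _
    simpa using this
  have hfatou : ∫⁻ ω : ℝ, ψ (ω * I) ≤ liminf (fun k => ∫⁻ ω, g k ω) atTop := by
    have := lintegral_liminf_le (μ := volume) (u := atTop) hgm
    simpa only [hgl] using this
  have hc0 : ENNReal.ofReal (1 / (2 * Real.pi)) ≠ 0 := by
    simp only [ne_eq, ENNReal.ofReal_eq_zero, not_le]
    positivity
  rw [e2, mul_comm, ← ENNReal.le_div_iff_mul_le (Or.inl hc0) (Or.inl ENNReal.ofReal_ne_top)]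
  refine hfatou.trans (liminf_le_of_le ?_ ?_)
  · isBoundedDefault
  · intro b hb
    obtain ⟨k, hk⟩ := hb.exists
    refine hk.trans ?_
    rw [ENNReal.le_div_iff_mul_le (Or.inl hc0) (Or.inl ENNReal.ofReal_ne_top), mul_comm]
    refine le_trans (le_of_eq ?_) (le_iSup₂_of_le (1 / ((k : ℝ) + 1)) (by positivity) le_rfl)
    simp_rw [lintegrand_transfer_eq]
    rfl

/-- The Lyapunov equation of a stable matrix is solvable in symmetric matrices. -/
lemma exists_lyapunov_solution {A : Matrix ι ι ℝ} (hA : IsLyapunovStable A) {Q : Matrix ι ι ℝ}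
    (hQ : Qᵀ = Q) : ∃ X : Matrix ι ι ℝ, Xᵀ = X ∧ A * X + X * Aᵀ = -Q := by
  let V := selfAdjoint.submodule ℝ (Matrix ι ι ℝ)
  have hV : ∀ X : Matrix ι ι ℝ, X ∈ V ↔ Xᵀ = X := fun X => by
    change star X = X ↔ _
    rw [star_eq_conjTranspose, conjTranspose_eq_transpose_of_trivial]
  let T : V →ₗ[ℝ] V :=
    { toFun := fun X => ⟨A * X + X * Aᵀ, (hV _).2 (by
        rw [transpose_add, transpose_mul, transpose_mul, transpose_transpose, (hV _).1 X.2,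
          add_comm])⟩
      map_add' := fun X Y => Subtype.ext (by simp [mul_add, add_mul]; abel)
      map_smul' := fun c X => Subtype.ext (by simp) }
  -- In finite dimension injectivity suffices. For X in the kernel the integral formula with Q = 0
  -- gives vᵀXv = 0 for all v, and polarization gives X = 0.
  have hinj : Function.Injective T := by
    rw [← LinearMap.ker_eq_bot, LinearMap.ker_eq_bot']
    intro X hX
    have hXs := (hV _).1 X.2
    have h0 : A * X + X * Aᵀ = -(0 : Matrix ι ι ℝ) := by
      rw [neg_zero]; exact congrArg Subtype.val hX
    have hq : ∀ v : ι → ℝ, v ⬝ᵥ ((X : Matrix ι ι ℝ) *ᵥ v) = 0 := fun v => by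
      have := (integral_hermForm_resolventRow hA hXs h0 v).2
      simpa [hermForm, Real.pi_ne_zero] using this.symm
    refine Subtype.ext ?_
    have hb : ∀ v w : ι → ℝ, v ⬝ᵥ ((X : Matrix ι ι ℝ) *ᵥ w) = 0 := fun v w => by
      have h1 := hq (v + w)
      simp only [mulVec_add, dotProduct_add, add_dotProduct, hq] at h1
      rw [dotProduct_mulVec_comm hXs w v] at h1
      linarith
    ext i j
    have := hb (Pi.single i 1) (Pi.single j 1)
    simpa using this
  obtain ⟨X, hX⟩ := LinearMap.injective_iff_surjective.1 hinj
    ⟨-Q, (hV _).2 (by rw [transpose_neg, hQ])⟩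
  exact ⟨X, (hV _).1 X.2, congrArg Subtype.val hX⟩

/-- Up to the factor 2π, vᵀXv is the integral of a nonnegative function. -/
lemma posSemidef_of_lyapunov {A X Q : Matrix ι ι ℝ} (hA : IsLyapunovStable A) (hX : Xᵀ = X)
    (hL : A * X + X * Aᵀ = -Q) (hQ : Q.PosSemidef) : X.PosSemidef := by
  refine posSemidef_iff_real.2 ⟨hX, fun v => ?_⟩
  have h1 := (integral_hermForm_resolventRow hA hX hL v).2
  have h2 : 0 ≤ ∫ ω : ℝ, hermForm Q (resolventRow A v (ω * I)) :=
    integral_nonneg fun ω => hermForm_nonneg hQ _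
  rw [h1] at h2
  exact nonneg_of_mul_nonneg_right h2 (by positivity)

/-- If vᵀXv = 0 then X v = 0, so the form of A X + X Aᵀ vanishes at v, whereas it equals -vᵀQv < 0.
-/
lemma posDef_of_lyapunov {A X Q : Matrix ι ι ℝ} (hA : IsLyapunovStable A) (hX : Xᵀ = X)
    (hL : A * X + X * Aᵀ = -Q) (hQ : Q.PosDef) : X.PosDef := by
  have hs := posSemidef_of_lyapunov hA hX hL hQ.posSemidef
  refine posDef_iff_real.2 ⟨hX, fun v hv => ?_⟩
  refine lt_of_le_of_ne ((posSemidef_iff_real.1 hs).2 v) fun h0 => ?_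
  have hXv : X *ᵥ v = 0 := (hs.dotProduct_mulVec_zero_iff v).1 (by simpa using h0.symm)
  have h1 : v ⬝ᵥ ((A * X + X * Aᵀ) *ᵥ v) = 0 := by
    rw [add_mulVec, ← mulVec_mulVec, ← mulVec_mulVec, hXv, dotProduct_add,
      dotProduct_mulVec_comm hX, hXv]
    simp
  rw [hL, neg_mulVec, dotProduct_neg] at h1
  linarith [(posDef_iff_real.1 hQ).2 v hv]

end H2

/-! ### Schur complements and the matrix inequalities -/

section LMI
open Matrix

variable {a b c d : Type} [Fintype a] [Fintype b] [Fintype c] [Fintype d]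
  [DecidableEq a] [DecidableEq b] [DecidableEq c] [DecidableEq d]

omit [Fintype a] [Fintype b] [DecidableEq a] [DecidableEq b] in
lemma sumElim_ne_zero {x : a → ℝ} {y : b → ℝ} (h : Sum.elim x y ≠ 0) : x ≠ 0 ∨ y ≠ 0 := by
  by_contra! h'
  exact h (by rw [h'.1, h'.2]; exact Sum.elim_zero_zero)

omit [DecidableEq a] in
lemma posDef_fromBlocks_iff₂₂ {A : Matrix a a ℝ} {B : Matrix a b ℝ} {D : Matrix b b ℝ}
    (hD : D.PosDef) : (fromBlocks A B Bᵀ D).PosDef ↔ (A - B * D⁻¹ * Bᵀ).PosDef := by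
  let _ := hD.isUnit.invertible
  rw [← conjTranspose_eq_transpose_of_trivial, posDef_iff_dotProduct_mulVec,
    posDef_iff_dotProduct_mulVec, IsHermitian.fromBlocks₂₂ _ _ hD.1]
  have hs := fun (x : a → ℝ) (y : b → ℝ) => schur_complement_eq₂₂ A B x y hD.1
  have hD' := posDef_iff_dotProduct_mulVec.1 hD
  refine and_congr_right fun _ => ⟨fun h x hx => ?_, fun h z hz => ?_⟩
  -- For fixed x this second component minimizes the form; the minimum is the Schur complement at x.
  · have h1 := h (x := Sum.elim x (-((D⁻¹ * Bᴴ) *ᵥ x))) fun h0 => hx (by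
      ext i; exact congrFun h0 (Sum.inl i))
    rw [dotProduct_mulVec, hs, add_neg_cancel] at h1
    simpa [dotProduct_mulVec] using h1
  · obtain ⟨x, y, rfl⟩ : ∃ x y, z = Sum.elim x y := ⟨_, _, (Sum.elim_comp_inl_inr z).symm⟩
    rw [dotProduct_mulVec, hs, ← dotProduct_mulVec, ← dotProduct_mulVec]
    by_cases hx : x = 0
    · have hy : y ≠ 0 := (sumElim_ne_zero hz).resolve_left (not_not_intro hx)
      simpa [hx] using hD'.2 hy
    · exact add_pos_of_nonneg_of_pos (hD.posSemidef.dotProduct_mulVec_nonneg _) (h hx)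

omit [DecidableEq b] in
lemma posDef_fromBlocks_iff₁₁ {A : Matrix a a ℝ} {B : Matrix a b ℝ} {D : Matrix b b ℝ}
    (hA : A.PosDef) : (fromBlocks A B Bᵀ D).PosDef ↔ (D - Bᵀ * A⁻¹ * B).PosDef := by
  have h := posDef_fromBlocks_iff₂₂ (A := D) (B := Bᵀ) hA
  rw [transpose_transpose] at h
  rw [← h]
  have e : (fromBlocks A B Bᵀ D).submatrix (Equiv.sumComm b a) (Equiv.sumComm b a) =
      fromBlocks D Bᵀ B A := fromBlocks_submatrix_sum_swap_sum_swap ..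
  have e' : (fromBlocks D Bᵀ B A).submatrix (Equiv.sumComm a b) (Equiv.sumComm a b) =
      fromBlocks A B Bᵀ D := fromBlocks_submatrix_sum_swap_sum_swap ..
  constructor
  · intro h1
    rw [← e]
    exact h1.submatrix (Equiv.injective _)
  · intro h1
    rw [← e']
    exact h1.submatrix (Equiv.injective _)

omit [DecidableEq a] in
/-- The Schur complements of the linear matrix inequality. -/
lemma posDef_neg_block3_iff {Q A : Matrix a a ℝ} {B : Matrix a b ℝ} {E : Matrix a c ℝ}
    {K : Matrix c a ℝ} {δ : ℝ} (hQ : Qᵀ = Q) (hδ : 0 < δ) :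
    (-(block3 (Q * A + Aᵀ * Q) (Q * B) (Q * E) (Bᵀ * Q) (-(δ • (1 : Matrix b b ℝ))) 0
        (Eᵀ * Q) 0 0
      + block3 (-(Kᵀ * K)) 0 Kᵀ 0 0 0 K 0 (-1))).PosDef ↔
    (-(Q * (A + E * K) + (A + E * K)ᵀ * Q + δ⁻¹ • (Q * B * Bᵀ * Q) + Q * E * Eᵀ * Q)).PosDef := by
  have e1 : -(block3 (Q * A + Aᵀ * Q) (Q * B) (Q * E) (Bᵀ * Q) (-(δ • (1 : Matrix b b ℝ))) 0
        (Eᵀ * Q) 0 0 + block3 (-(Kᵀ * K)) 0 Kᵀ 0 0 0 K 0 (-1)) =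
      fromBlocks (fromBlocks (Kᵀ * K - (Q * A + Aᵀ * Q)) (-(Q * B)) (-(Q * B))ᵀ
        (δ • (1 : Matrix b b ℝ))) (fromRows (-(Q * E + Kᵀ)) 0)
        (fromRows (-(Q * E + Kᵀ)) (0 : Matrix b c ℝ))ᵀ 1 := by
    rw [block3, block3, fromBlocks_add, fromBlocks_add, fromBlocks_neg, fromBlocks_neg,
      transpose_fromRows]
    congr 1
    · congr 1
      · abel
      · simp
      · simp [hQ]
      · simp
    · ext (i | i) j <;> simp
    · ext i (j | j) <;> simp [hQ, transpose_mul]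
    · simp
  have e2 : fromBlocks (Kᵀ * K - (Q * A + Aᵀ * Q)) (-(Q * B)) (-(Q * B))ᵀ
        (δ • (1 : Matrix b b ℝ)) - fromRows (-(Q * E + Kᵀ)) 0 * (1 : Matrix c c ℝ)⁻¹ *
        (fromRows (-(Q * E + Kᵀ)) (0 : Matrix b c ℝ))ᵀ =
      fromBlocks (Kᵀ * K - (Q * A + Aᵀ * Q) - (Q * E + Kᵀ) * (Eᵀ * Q + K)) (-(Q * B)) (-(Q * B))ᵀ
        (δ • (1 : Matrix b b ℝ)) := by
    rw [inv_one, Matrix.mul_one, transpose_fromRows, fromRows_mul_fromCols, sub_eq_add_neg,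
      fromBlocks_neg, fromBlocks_add]
    have e : Kᵀ * K - (Q * A + Aᵀ * Q) + -(-(Q * E + Kᵀ) * (-(Q * E + Kᵀ))ᵀ) =
        Kᵀ * K - (Q * A + Aᵀ * Q) - (Q * E + Kᵀ) * (Eᵀ * Q + K) := by
      rw [transpose_neg, Matrix.neg_mul, Matrix.mul_neg, neg_neg, transpose_add, transpose_mul, hQ,
        transpose_transpose, ← sub_eq_add_neg]
    rw [e]
    simp
  have hδ1 : (δ • (1 : Matrix b b ℝ)).PosDef := PosDef.one.smul hδ
  have hinv : (δ • (1 : Matrix b b ℝ))⁻¹ = δ⁻¹ • 1 :=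
    inv_eq_right_inv (by rw [smul_mul_smul_comm, mul_inv_cancel₀ hδ.ne', one_smul, Matrix.mul_one])
  -- The block 1 is eliminated first, which completes the square in K; then the block δ·1.
  rw [e1, posDef_fromBlocks_iff₂₂ PosDef.one, e2, posDef_fromBlocks_iff₂₂ hδ1, hinv]
  have e3 : Kᵀ * K - (Q * A + Aᵀ * Q) - (Q * E + Kᵀ) * (Eᵀ * Q + K) -
      -(Q * B) * δ⁻¹ • (1 : Matrix b b ℝ) * (-(Q * B))ᵀ =
      -(Q * (A + E * K) + (A + E * K)ᵀ * Q + δ⁻¹ • (Q * B * Bᵀ * Q) + Q * E * Eᵀ * Q) := by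
    simp only [transpose_neg, transpose_mul, hQ, Matrix.mul_smul, Matrix.mul_one, Matrix.smul_mul,
      Matrix.neg_mul, Matrix.mul_neg, neg_neg, smul_neg, Matrix.mul_add, Matrix.add_mul,
      transpose_add, Matrix.mul_assoc]
    abel
  rw [e3]

omit [Fintype a] [DecidableEq a] in
lemma posDef_smul_iff {X : Matrix a a ℝ} {δ : ℝ} (hδ : 0 < δ) : (δ • X).PosDef ↔ X.PosDef := by
  refine ⟨fun h => ?_, fun h => h.smul hδ⟩
  have := h.smul (inv_pos.2 hδ)
  rwa [smul_smul, inv_mul_cancel₀ hδ.ne', one_smul] at this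

omit [DecidableEq b] [DecidableEq c] in
/-- The Riccati inequality in `Q` and the Lyapunov inequality in `X = δ Q⁻¹` are equivalent. -/
lemma posDef_riccati_iff_lyapunov {Q X A : Matrix a a ℝ} {B : Matrix a b ℝ} {E : Matrix a c ℝ}
    {δ : ℝ} (hδ : 0 < δ) (hX : X.PosDef) (hQX : Q * X = δ • 1) (hXQ : X * Q = δ • 1) :
    (-(Q * A + Aᵀ * Q + δ⁻¹ • (Q * B * Bᵀ * Q) + Q * E * Eᵀ * Q)).PosDef ↔
    (-(A * X + X * Aᵀ + B * Bᵀ + δ • (E * Eᵀ))).PosDef := by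
  have hXt : star X = X := hX.1.eq
  -- Congruence by X turns every Q into δ, so the whole expression acquires one factor δ.
  rw [← hX.isUnit.posDef_star_left_conjugate_iff, hXt, ← posDef_smul_iff hδ (X := -(A * X + _ + _ + _))]
  have l : ∀ {e : Type} (Y : Matrix a e ℝ), X * (Q * Y) = δ • Y := fun Y => by
    rw [← Matrix.mul_assoc, hXQ, Matrix.smul_mul, Matrix.one_mul]
  have e : X * -(Q * A + Aᵀ * Q + δ⁻¹ • (Q * B * Bᵀ * Q) + Q * E * Eᵀ * Q) * X =
      δ • -(A * X + X * Aᵀ + B * Bᵀ + δ • (E * Eᵀ)) := by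
    simp only [Matrix.mul_neg, Matrix.neg_mul, Matrix.mul_add, Matrix.add_mul, Matrix.mul_smul,
      Matrix.smul_mul, Matrix.mul_assoc, hQX, l, Matrix.mul_one, smul_add, smul_neg, smul_smul,
      inv_mul_cancel₀ hδ.ne', one_smul]
  rw [e]

/-- Feasibility of the linear matrix inequalities in terms of a Lyapunov inequality. -/
lemma exists_lmi_iff_exists_lyapunov {A : Matrix a a ℝ} {B : Matrix a b ℝ} {E : Matrix a c ℝ}
    {K : Matrix c a ℝ} {C : Matrix d a ℝ} {γ : ℝ} :
    (∃ (Q : Matrix a a ℝ) (R : Matrix d d ℝ) (δ : ℝ), Q.PosDef ∧ R.PosDef ∧ 0 < δ ∧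
      (-(block3 (Q * A + Aᵀ * Q) (Q * B) (Q * E) (Bᵀ * Q) (-(δ • (1 : Matrix b b ℝ))) 0
          (Eᵀ * Q) 0 0
        + block3 (-(Kᵀ * K)) 0 Kᵀ 0 0 0 K 0 (-1))).PosDef ∧
      (fromBlocks Q (δ • Cᵀ) (δ • C) R).PosDef ∧ R.trace < δ * γ) ↔
    ∃ (X : Matrix a a ℝ) (δ : ℝ), X.PosDef ∧ 0 < δ ∧
      (-((A + E * K) * X + X * (A + E * K)ᵀ + B * Bᵀ + δ • (E * Eᵀ))).PosDef ∧
      (C * X * Cᵀ).trace < γ := by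
  have hC : ∀ δ : ℝ, δ • C = (δ • Cᵀ)ᵀ := fun δ => by
    rw [transpose_smul, transpose_transpose]
  constructor
  · rintro ⟨Q, R, δ, hQ, hR, hδ, h1, h2, h3⟩
    have hQd : IsUnit Q.det := (isUnit_iff_isUnit_det _).1 hQ.isUnit
    have hX : (δ • Q⁻¹).PosDef := hQ.inv.smul hδ
    refine ⟨δ • Q⁻¹, δ, hX, hδ, ?_, ?_⟩
    · rw [posDef_neg_block3_iff (transpose_eq_of_posDef hQ) hδ] at h1
      exact (posDef_riccati_iff_lyapunov hδ hX (by rw [Matrix.mul_smul, mul_nonsing_inv _ hQd])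
        (by rw [Matrix.smul_mul, nonsing_inv_mul _ hQd])).1 h1
    · rw [hC, posDef_fromBlocks_iff₁₁ hQ] at h2
      -- The Schur complement is R - δ C X Cᵀ; a nonnegative trace is enough, as the bound on tr R
      -- is already strict.
      have h4 := h2.posSemidef.trace_nonneg
      have e : (δ • Cᵀ)ᵀ * Q⁻¹ * δ • Cᵀ = δ • (C * (δ • Q⁻¹) * Cᵀ) := by
        simp [transpose_smul, Matrix.smul_mul, Matrix.mul_smul]
      rw [e, trace_sub, trace_smul, smul_eq_mul] at h4
      have : δ * (C * (δ • Q⁻¹) * Cᵀ).trace < δ * γ := by linarith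
      exact lt_of_mul_lt_mul_left this hδ.le
  · rintro ⟨X, δ, hX, hδ, h1, h2⟩
    have hXd : IsUnit X.det := (isUnit_iff_isUnit_det _).1 hX.isUnit
    have hQ : (δ • X⁻¹).PosDef := hX.inv.smul hδ
    -- η makes R strictly larger than δ C X Cᵀ while keeping its trace below δγ; the 1 added to the
    -- dimension keeps the bound strict.
    obtain ⟨η, hη, hηγ⟩ : ∃ η : ℝ, 0 < η ∧ (C * X * Cᵀ).trace + η * Fintype.card d < γ := by
      refine ⟨(γ - (C * X * Cᵀ).trace) / (Fintype.card d + 1),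
        div_pos (by linarith) (by positivity), ?_⟩
      rw [div_mul_eq_mul_div, ← lt_sub_iff_add_lt', div_lt_iff₀ (by positivity)]
      nlinarith
    have hη1 : (η • (1 : Matrix d d ℝ)).PosDef := PosDef.one.smul hη
    have hR : (δ • (C * X * Cᵀ + η • 1)).PosDef := by
      refine PosDef.smul (PosDef.posSemidef_add ?_ hη1) hδ
      simpa using hX.posSemidef.mul_mul_conjTranspose_same C
    refine ⟨δ • X⁻¹, δ • (C * X * Cᵀ + η • 1), δ, hQ, hR, hδ, ?_, ?_, ?_⟩
    · rw [posDef_neg_block3_iff (transpose_eq_of_posDef hQ) hδ]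
      exact (posDef_riccati_iff_lyapunov hδ hX (by rw [Matrix.smul_mul, nonsing_inv_mul _ hXd])
        (by rw [Matrix.mul_smul, mul_nonsing_inv _ hXd])).2 h1
    · rw [hC, posDef_fromBlocks_iff₁₁ hQ]
      have hi : (δ • X⁻¹)⁻¹ = δ⁻¹ • X := inv_eq_right_inv (by
        rw [smul_mul_smul_comm, mul_inv_cancel₀ hδ.ne', one_smul, nonsing_inv_mul _ hXd])
      have e : δ • (C * X * Cᵀ + η • 1) - (δ • Cᵀ)ᵀ * (δ • X⁻¹)⁻¹ * δ • Cᵀ =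
          δ • η • (1 : Matrix d d ℝ) := by
        rw [hi]
        simp [transpose_smul, Matrix.smul_mul, Matrix.mul_smul, smul_smul, hδ.ne']
      rw [e]
      exact hη1.smul hδ
    · rw [trace_smul, trace_add, trace_smul, trace_one, smul_eq_mul, smul_eq_mul]
      exact mul_lt_mul_of_pos_left hηγ hδ

end LMI

/-! ### Laplacians of balanced, strongly connected graphs -/

section EdgeLaplacian
open Matrix

variable {n : ℕ}

/-- `K` is the Laplacian of a balanced strongly connected graph: it annihilates constants on both
sides and its quadratic form is positive on nonconstant vectors. -/
structure IsBalancedLaplacian (K : Matrix (Fin n) (Fin n) ℝ) : Prop where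
  mulVec_one : K *ᵥ 1 = 0
  one_vecMul : 1 ᵥ* K = 0
  pos : ∀ y, (∀ i j, y i = y j) ∨ 0 < y ⬝ᵥ (K *ᵥ y)

/-- Balance, applied to the squares y_i², symmetrizes yᵀKy into ½ ∑ w (y_src - y_tgt)². If this
vanishes, y is constant along every edge of positive weight, hence everywhere. -/
lemma isBalancedLaplacian_of_edges {ε : Type} [Fintype ε] {K : Matrix (Fin n) (Fin n) ℝ}
    {src tgt : ε → Fin n} {w : ε → ℝ} (hw : ∀ e, 0 ≤ w e)
    (hK : ∀ x y, x ⬝ᵥ (K *ᵥ y) = ∑ e, w e * (x (src e) * (y (src e) - y (tgt e))))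
    (hb : ∀ x : Fin n → ℝ, ∑ e, w e * x (src e) = ∑ e, w e * x (tgt e))
    (hconn : ∀ i j, Relation.ReflTransGen (fun a b => ∃ e, src e = a ∧ tgt e = b ∧ 0 < w e) i j) :
    IsBalancedLaplacian K where
  mulVec_one := by
    ext i
    have := hK (Pi.single i 1) 1
    simpa using this
  one_vecMul := by
    ext j
    have := hK 1 (Pi.single j 1)
    rw [dotProduct_mulVec] at this
    simp only [Pi.one_apply, one_mul, mul_sub, Finset.sum_sub_distrib, hb, sub_self] at this
    simpa using this
  pos := fun y => by
    have hq : 2 * (y ⬝ᵥ (K *ᵥ y)) = ∑ e, w e * (y (src e) - y (tgt e)) ^ 2 := by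
      have h1 := hb fun i => y i ^ 2
      have h2 : ∑ e, w e * (y (src e) - y (tgt e)) ^ 2 =
          2 * ∑ e, w e * (y (src e) * (y (src e) - y (tgt e))) +
          ((∑ e, w e * y (tgt e) ^ 2) - ∑ e, w e * y (src e) ^ 2) := by
        rw [Finset.mul_sum, ← Finset.sum_sub_distrib, ← Finset.sum_add_distrib]
        exact Finset.sum_congr rfl fun e _ => by ring
      rw [h2, hK, h1, sub_self, add_zero]
    have hnn : ∀ e ∈ Finset.univ, 0 ≤ w e * (y (src e) - y (tgt e)) ^ 2 := fun e _ =>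
      mul_nonneg (hw e) (sq_nonneg _)
    rcases (Finset.sum_nonneg hnn).eq_or_lt with h0 | h0
    · left
      intro i j
      have hstep := (Finset.sum_eq_zero_iff_of_nonneg hnn).1 h0.symm
      induction hconn i j with
      | refl => rfl
      | tail _ h ih =>
        obtain ⟨e, rfl, rfl, he⟩ := h
        have := hstep e (Finset.mem_univ e)
        rw [ih]
        have h1 : (y (src e) - y (tgt e)) ^ 2 = 0 := (mul_eq_zero.1 this).resolve_left he.ne'
        exact sub_eq_zero.1 (pow_eq_zero_iff two_ne_zero |>.1 h1)
    · right
      linarith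

lemma laplacian_mulVec_apply (A : Matrix (Fin n) (Fin n) ℝ) (y : Fin n → ℝ) (i : Fin n) :
    (laplacian A *ᵥ y) i = ∑ j, A i j * (y i - y j) := by
  have h : ∀ j, laplacian A i j * y j =
      (if i = j then (∑ k ∈ Finset.univ.erase i, A i k + A i i) * y i else 0) - A i j * y j := by
    intro j
    by_cases h : i = j
    · subst h
      simp only [laplacian, of_apply, if_true]
      ring
    · simp [laplacian, h]
  simp only [mulVec, dotProduct, h, Finset.sum_sub_distrib, mul_sub]
  rw [Finset.sum_ite_eq, if_pos (Finset.mem_univ _), Finset.sum_erase_add _ _ (Finset.mem_univ i),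
    Finset.sum_mul]

variable {p q r : ℕ}

lemma Network.isBalancedLaplacian_Lb (N : Network n p q) {μ : Fin n → ℝ} (hμ : ∀ i, 0 < μ i)
    (hbal : IsBalanced (diagonal μ * N.A)) : IsBalancedLaplacian (N.Lb (diagonal μ)) := by
  -- All ordered pairs serve as edges; non-edges carry weight 0.
  refine isBalancedLaplacian_of_edges (ε := Fin n × Fin n) (src := Prod.fst) (tgt := Prod.snd)
    (w := fun e => μ e.1 * N.A e.1 e.2) (fun e => mul_nonneg (hμ _).le (N.nonneg _ _)) ?_ ?_ ?_
  · intro x y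
    rw [Fintype.sum_prod_type, Network.Lb, Network.L, ← mulVec_mulVec]
    refine Finset.sum_congr rfl fun i _ => ?_
    rw [mulVec_diagonal, laplacian_mulVec_apply, Finset.mul_sum, Finset.mul_sum]
    exact Finset.sum_congr rfl fun j _ => by ring
  · intro x
    rw [Fintype.sum_prod_type, Fintype.sum_prod_type_right]
    refine Finset.sum_congr rfl fun i _ => ?_
    have := hbal i
    simp only [diagonal_mul] at this
    simp only [← Finset.sum_mul, this]
  · intro i j
    refine Relation.ReflTransGen.mono (fun a b h => ?_) i j (N.stronglyConnected i j)
    exact ⟨(a, b), rfl, rfl, mul_pos (hμ a) h⟩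

lemma incidence_transpose_mulVec {adj : Fin n → Fin n → Prop} (hadj : ∀ i, ¬ adj i i)
    (y : Fin n → ℝ) (e : Edge adj) :
    ((incidence adj)ᵀ *ᵥ y) e = y e.1.1 - y e.1.2 := by
  have hne : e.1.1 ≠ e.1.2 := fun h => hadj e.1.1 (by have := e.2; rwa [← h] at this)
  have h : ∀ i, incidence adj i e * y i =
      (if e.1.1 = i then y i else 0) - (if e.1.2 = i then y i else 0) := by
    intro i
    by_cases h1 : e.1.1 = i
    · have h2 : e.1.2 ≠ i := fun h => hne (h1.trans h.symm)
      simp [incidence, h1, h2]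
    · by_cases h2 : e.1.2 = i <;> simp [incidence, h1, h2]
  simp [mulVec, dotProduct, h]

lemma incidence₀_transpose_mulVec {adj : Fin n → Fin n → Prop} (y : Fin n → ℝ) (e : Edge adj) :
    ((incidence₀ adj)ᵀ *ᵥ y) e = y e.1.1 := by
  have h : ∀ i, incidence₀ adj i e * y i = if e.1.1 = i then y i else 0 := by
    intro i
    by_cases h1 : e.1.1 = i
    · have : (1 : ℝ) ≠ -1 := by norm_num
      simp [incidence₀, incidence, h1, this]
    · by_cases h2 : e.1.2 = i <;> simp [incidence₀, incidence, h1, h2]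
  simp [mulVec, dotProduct, h]

lemma Network.isBalancedLaplacian_LbHat (N : Network n p q) {c : Fin n → Fin r}
    (hc : Function.Surjective c) {W : Matrix (Edge (N.quotAdj c)) (Edge (N.quotAdj c)) ℝ}
    (hW : W ∈ N.weights c) : IsBalancedLaplacian (N.LbHat c W) := by
  classical
  obtain ⟨w, hw, hbal, hWw⟩ := hW
  have hadj : ∀ k, ¬ N.quotAdj c k k := fun k h => h.1 rfl
  refine isBalancedLaplacian_of_edges (src := fun e : Edge (N.quotAdj c) => e.1.1)
    (tgt := fun e => e.1.2) (w := w) (fun e => (hw e).le) ?_ ?_ ?_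
  · intro x y
    have h1 : N.LbHat c W *ᵥ y = incidence₀ (N.quotAdj c) *ᵥ
        (diagonal w *ᵥ ((incidence (N.quotAdj c))ᵀ *ᵥ y)) := by
      rw [mulVec_mulVec, mulVec_mulVec, Network.LbHat, hWw]
    rw [h1, dotProduct_mulVec, ← mulVec_transpose]
    refine Finset.sum_congr rfl fun e _ => ?_
    rw [mulVec_diagonal, incidence₀_transpose_mulVec, incidence_transpose_mulVec hadj]
    ring
  · intro x
    have h1 : x ⬝ᵥ (incidence (N.quotAdj c) *ᵥ w) = 0 := by rw [hbal, dotProduct_zero]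
    rw [dotProduct_mulVec, ← mulVec_transpose] at h1
    simp only [dotProduct, incidence_transpose_mulVec hadj, sub_mul, Finset.sum_sub_distrib] at h1
    simp only [mul_comm (w _)]
    linarith
  · intro k l
    obtain ⟨i, rfl⟩ := hc k
    obtain ⟨j, rfl⟩ := hc l
    induction N.stronglyConnected i j with
    | refl => exact .refl
    | @tail a b _ hab ih =>
      by_cases h : c a = c b
      · rwa [← h]
      · exact ih.tail ⟨⟨(c a, c b), h, a, b, rfl, rfl, hab⟩, rfl, rfl, hw _⟩

end EdgeLaplacian

/-! ### Reduction to the disagreement space -/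

section Reduction
open Matrix

variable {n : ℕ}

lemma S_transpose_mulVec_apply (hn : 0 < n) (y : Fin n → ℝ) (j : Fin (n - 1)) :
    ((S n)ᵀ *ᵥ y) j = y ⟨n - 1, by omega⟩ - y ⟨j, by omega⟩ := by
  have h : ∀ i : Fin n, S n i j * y i =
      (if i = ⟨n - 1, by omega⟩ then y i else 0) - (if i = ⟨j, by omega⟩ then y i else 0) := by
    intro i
    have hj := j.2
    by_cases h1 : i.val = j.val
    · have h2 : ¬ (j : ℕ) = n - 1 := by omega
      simp [S, Fin.ext_iff, h1, h2]
    · have h3 : ¬ n - 1 = (j : ℕ) := by omega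
      by_cases h2 : i.val = n - 1 <;> simp [S, Fin.ext_iff, h1, h2, h3]
  simp [mulVec, dotProduct, h]

lemma S_transpose_mulVec_one (hn : 0 < n) : (S n)ᵀ *ᵥ 1 = 0 := by
  ext j
  simp [S_transpose_mulVec_apply hn]

lemma eq_of_S_transpose_mulVec_eq_zero (hn : 0 < n) {y : Fin n → ℝ} (h : (S n)ᵀ *ᵥ y = 0)
    (i : Fin n) : y i = y ⟨n - 1, by omega⟩ := by
  by_cases hi : i.val < n - 1
  · have := congrFun h ⟨i, hi⟩
    rw [S_transpose_mulVec_apply hn] at this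
    exact (sub_eq_zero.1 this).symm
  · congr 1
    ext
    simp only
    omega

lemma S_mulVec_injective : Function.Injective (S n).mulVec := by
  intro x y h
  ext j
  have hz : S n *ᵥ (x - y) = 0 := by rw [mulVec_sub, sub_eq_zero]; exact h
  have h1 := congrFun hz ⟨j, by omega⟩
  have h2 : ∀ k, S n ⟨j, by omega⟩ k * (x - y) k = if j = k then -(x - y) k else 0 := by
    intro k
    have hj := j.2
    have h3 : ¬ (j : ℕ) = n - 1 := by omega
    by_cases h4 : j = k
    · simp [S, h4]
    · simp [S, h4, h3, Fin.val_inj]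
  simp only [mulVec, dotProduct, h2] at h1
  simp at h1
  linarith

/-- The all-ones matrix. -/
def allOnes (m n : ℕ) : Matrix (Fin m) (Fin n) ℝ := Matrix.of fun _ _ => 1

variable {d : Fin n → ℝ}

lemma inv_diagonal_of_pos (hd : ∀ i, 0 < d i) : (diagonal d)⁻¹ = diagonal fun i => (d i)⁻¹ := by
  apply inv_eq_right_inv
  rw [diagonal_mul_diagonal, ← diagonal_one]
  congr 1
  ext i
  exact mul_inv_cancel₀ (hd i).ne'

lemma isUnit_det_diagonal_of_pos (hd : ∀ i, 0 < d i) : IsUnit (diagonal d).det := by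
  rw [det_diagonal, isUnit_iff_ne_zero]
  exact Finset.prod_ne_zero_iff.2 fun i _ => (hd i).ne'

lemma posDef_S_transpose_mul_inv_mul_S (hd : ∀ i, 0 < d i) :
    ((S n)ᵀ * (diagonal d)⁻¹ * S n).PosDef := by
  have h : (diagonal d).PosDef := PosDef.diagonal hd
  simpa using h.inv.conjTranspose_mul_mul_same (B := S n) S_mulVec_injective

lemma gram_mul_Splus (hd : ∀ i, 0 < d i) :
    ((S n)ᵀ * (diagonal d)⁻¹ * S n) * Splus (diagonal d) = (S n)ᵀ * (diagonal d)⁻¹ := by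
  have h := (isUnit_iff_isUnit_det _).1 (posDef_S_transpose_mul_inv_mul_S hd).isUnit
  rw [Splus, Matrix.mul_assoc _ (S n)ᵀ, ← Matrix.mul_assoc, mul_nonsing_inv _ h, Matrix.one_mul]

/-- The kernel of Sᵀ M⁻¹ is spanned by the diagonal of M, whose entries have positive sum.
Identities such as that for S S⁺ may thus be tested by Sᵀ M⁻¹ and by column sums. -/
lemma eq_zero_of_S_transpose_mul_eq_zero {m : ℕ} (hn : 0 < n) (hd : ∀ i, 0 < d i)
    {Z : Matrix (Fin n) (Fin m) ℝ} (h1 : (S n)ᵀ * (diagonal d)⁻¹ * Z = 0)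
    (h2 : ∀ j, ∑ i, Z i j = 0) : Z = 0 := by
  have hz : ∀ i j, Z i j = d i * ((d ⟨n - 1, by omega⟩)⁻¹ * Z ⟨n - 1, by omega⟩ j) := by
    intro i j
    have h3 : (S n)ᵀ *ᵥ (fun i => (d i)⁻¹ * Z i j) = 0 := by
      rw [Matrix.mul_assoc, inv_diagonal_of_pos hd] at h1
      ext k
      have := congrFun (congrFun h1 k) j
      simpa [Matrix.mul_apply, mulVec, dotProduct, diagonal_apply] using this
    have h4 := eq_of_S_transpose_mulVec_eq_zero hn h3 i
    rw [← h4, ← mul_assoc, mul_inv_cancel₀ (hd i).ne', one_mul]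
  have hne : (∑ i, d i) ≠ 0 := by
    have : Nonempty (Fin n) := ⟨⟨0, hn⟩⟩
    exact (Finset.sum_pos (fun i _ => hd i) Finset.univ_nonempty).ne'
  ext i j
  have h5 := h2 j
  rw [Finset.sum_congr rfl fun i _ => hz i j, ← Finset.sum_mul] at h5
  rw [hz i j, (mul_eq_zero.1 h5).resolve_left hne, mul_zero, Matrix.zero_apply]

/-- `S S⁺` is the projection onto the vectors of zero sum along the diagonal of `M`. -/
lemma S_mul_Splus (hn : 0 < n) (hd : ∀ i, 0 < d i) :
    S n * Splus (diagonal d) = 1 - (∑ i, d i)⁻¹ • (diagonal d * allOnes n n) := by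
  have hne : (∑ i, d i) ≠ 0 := by
    have : Nonempty (Fin n) := ⟨⟨0, hn⟩⟩
    exact (Finset.sum_pos (fun i _ => hd i) Finset.univ_nonempty).ne'
  have hS1 : (S n)ᵀ * allOnes n n = 0 := by
    ext i j
    have := congrFun (S_transpose_mulVec_one hn) i
    simpa [Matrix.mul_apply, mulVec, dotProduct, allOnes] using this
  rw [← sub_eq_zero]
  refine eq_zero_of_S_transpose_mul_eq_zero hn hd ?_ fun j => ?_
  · rw [Matrix.mul_sub, ← Matrix.mul_assoc, gram_mul_Splus hd, Matrix.mul_sub, Matrix.mul_one,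
      sub_sub_cancel, Matrix.mul_smul, Matrix.mul_assoc, ← Matrix.mul_assoc (diagonal d)⁻¹,
      nonsing_inv_mul _ (isUnit_det_diagonal_of_pos hd), Matrix.one_mul, hS1, smul_zero]
  · have hS : ∀ k, ∑ i, S n i k = 0 := fun k => by
      have := congrFun (S_transpose_mulVec_one hn) k
      simpa [mulVec, dotProduct] using this
    have h1 : ∑ i, (S n * Splus (diagonal d)) i j = 0 := by
      simp only [Matrix.mul_apply]
      rw [Finset.sum_comm]
      simp only [← Finset.sum_mul, hS, zero_mul, Finset.sum_const_zero]
    simp only [Matrix.sub_apply, Matrix.smul_apply, diagonal_mul, allOnes, of_apply, mul_one, smul_eq_mul,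
      Finset.sum_sub_distrib, h1, ← Finset.mul_sum, inv_mul_cancel₀ hne]
    simp [Matrix.one_apply]

/-- The matrix `-S⁺ K M⁻¹ S` of the dynamics `x' = -M⁻¹ K x` on the disagreement space. -/
def disagreement (M K : Matrix (Fin n) (Fin n) ℝ) : Matrix (Fin (n - 1)) (Fin (n - 1)) ℝ :=
  -(Splus M * K * M⁻¹ * S n)

variable {K : Matrix (Fin n) (Fin n) ℝ}

/-- For P = Sᵀ M⁻¹ S and y = M⁻¹ S x, the derivative xᵀ P A x is -yᵀKy. A constant y must be 0,
since S x = M y has zero sum. -/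
lemma isLyapunovStable_disagreement (hn : 0 < n) (hd : ∀ i, 0 < d i)
    (hK : IsBalancedLaplacian K) : IsLyapunovStable (disagreement (diagonal d) K) := by
  refine ⟨_, posDef_S_transpose_mul_inv_mul_S hd, fun x hx => ?_⟩
  set y : Fin n → ℝ := (diagonal d)⁻¹ *ᵥ (S n *ᵥ x) with hy
  have hSx : S n *ᵥ x = diagonal d *ᵥ y := by
    rw [hy, mulVec_mulVec, mul_nonsing_inv _ (isUnit_det_diagonal_of_pos hd), one_mulVec]
  have hsymm : ((diagonal d)⁻¹)ᵀ = (diagonal d)⁻¹ := by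
    rw [inv_diagonal_of_pos hd, diagonal_transpose]
  have e : x ⬝ᵥ (((S n)ᵀ * (diagonal d)⁻¹ * S n) *ᵥ (disagreement (diagonal d) K *ᵥ x)) =
      -(y ⬝ᵥ (K *ᵥ y)) := by
    rw [disagreement, neg_mulVec, mulVec_neg, dotProduct_neg, mulVec_mulVec, ← Matrix.mul_assoc,
      ← Matrix.mul_assoc, ← Matrix.mul_assoc, gram_mul_Splus hd, ← mulVec_mulVec,
      ← mulVec_mulVec, ← hy, ← mulVec_mulVec, ← mulVec_mulVec, dotProduct_mulVec,
      vecMul_transpose, dotProduct_mulVec, ← mulVec_transpose, hsymm, ← hy]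
  rw [e, neg_lt_zero]
  refine (hK.pos y).resolve_left fun hconst => hx ?_
  have hsum : ∑ i, (S n *ᵥ x) i = 0 := by
    have : (1 : Fin n → ℝ) ⬝ᵥ (S n *ᵥ x) = 0 := by
      rw [dotProduct_mulVec, ← mulVec_transpose, S_transpose_mulVec_one hn, zero_dotProduct]
    simpa [dotProduct] using this
  have : Nonempty (Fin n) := ⟨⟨0, hn⟩⟩
  have hy0 : ∀ i, y i = 0 := fun i => by
    simp only [hSx, mulVec_diagonal] at hsum
    rw [Finset.sum_congr rfl fun j _ => by rw [hconst j i], ← Finset.sum_mul] at hsum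
    exact (mul_eq_zero.1 hsum).resolve_left
      (Finset.sum_pos (fun i _ => hd i) Finset.univ_nonempty).ne'
  apply S_mulVec_injective
  rw [hSx, show y = 0 from funext hy0, mulVec_zero, mulVec_zero]

lemma map_ofReal_mul {a b c : Type} [Fintype b] (X : Matrix a b ℝ) (Y : Matrix b c ℝ) :
    (X * Y).map Complex.ofReal = X.map Complex.ofReal * Y.map Complex.ofReal :=
  Matrix.map_mul (f := Complex.ofRealHom)

/-- Splitting of the resolvent into the disagreement dynamics and the average. -/
lemma inv_smul_one_add_map (hn : 0 < n) (hd : ∀ i, 0 < d i) (hK : IsBalancedLaplacian K) {s : ℂ}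
    (hs : 0 < s.re) :
    (s • (1 : Matrix (Fin n) (Fin n) ℂ) - (-((diagonal d)⁻¹ * K)).map Complex.ofReal) *
      ((((diagonal d)⁻¹ * S n).map Complex.ofReal *
        (s • 1 - (disagreement (diagonal d) K).map Complex.ofReal)⁻¹ *
        (Splus (diagonal d) * diagonal d).map Complex.ofReal) +
        s⁻¹ • (((∑ i, d i)⁻¹ • (allOnes n n * diagonal d)).map Complex.ofReal)) = 1 := by
  have hJK : allOnes n n * K = 0 := by
    ext i j
    have := congrFun hK.one_vecMul j
    simpa [Matrix.mul_apply, vecMul, dotProduct, allOnes] using this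
  have hKJ : K * allOnes n n = 0 := by
    ext i j
    have := congrFun hK.mulVec_one i
    simpa [Matrix.mul_apply, mulVec, dotProduct, allOnes] using this
  -- The columns of K have zero sum, so the projection S S⁺ fixes K; this makes M⁻¹ S intertwine the
  -- two dynamics.
  have hSK : S n * (Splus (diagonal d) * K) = K := by
    rw [← Matrix.mul_assoc, S_mul_Splus hn hd, Matrix.sub_mul, Matrix.one_mul, Matrix.smul_mul,
      Matrix.mul_assoc, hJK, Matrix.mul_zero, smul_zero, sub_zero]
  have hLT : (-((diagonal d)⁻¹ * K)) * ((diagonal d)⁻¹ * S n) =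
      ((diagonal d)⁻¹ * S n) * disagreement (diagonal d) K := by
    rw [disagreement, Matrix.mul_neg, Matrix.neg_mul]
    congr 1
    have : (diagonal d)⁻¹ * S n * (Splus (diagonal d) * K * (diagonal d)⁻¹ * S n) =
        (diagonal d)⁻¹ * (S n * (Splus (diagonal d) * K)) * ((diagonal d)⁻¹ * S n) := by
      simp only [Matrix.mul_assoc]
    rw [this, hSK]
  have hLJ : (-((diagonal d)⁻¹ * K)) * ((∑ i, d i)⁻¹ • (allOnes n n * diagonal d)) = 0 := by
    rw [Matrix.mul_smul, Matrix.neg_mul, Matrix.mul_assoc, ← Matrix.mul_assoc K, hKJ,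
      Matrix.zero_mul, Matrix.mul_zero, neg_zero, smul_zero]
  have hTS : ((diagonal d)⁻¹ * S n) * (Splus (diagonal d) * diagonal d) +
      (∑ i, d i)⁻¹ • (allOnes n n * diagonal d) = 1 := by
    have hu := isUnit_det_diagonal_of_pos hd
    rw [Matrix.mul_assoc, ← Matrix.mul_assoc (S n), S_mul_Splus hn hd, Matrix.sub_mul,
      Matrix.one_mul, Matrix.mul_sub, nonsing_inv_mul _ hu, Matrix.smul_mul, Matrix.mul_smul,
      Matrix.mul_assoc, ← Matrix.mul_assoc _ (diagonal d), nonsing_inv_mul _ hu, Matrix.one_mul,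
      sub_add_cancel]
  have hunit := (isLyapunovStable_disagreement hn hd hK).isUnit_det hs.le
  have hs0 : s ≠ 0 := fun h => by simp [h] at hs
  have hcomm : (s • (1 : Matrix (Fin n) (Fin n) ℂ) -
      (-((diagonal d)⁻¹ * K)).map Complex.ofReal) * ((diagonal d)⁻¹ * S n).map Complex.ofReal =
      ((diagonal d)⁻¹ * S n).map Complex.ofReal *
        (s • 1 - (disagreement (diagonal d) K).map Complex.ofReal) := by
    rw [Matrix.sub_mul, Matrix.mul_sub, ← map_ofReal_mul, ← map_ofReal_mul, hLT, Matrix.smul_mul,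
      Matrix.mul_smul, Matrix.one_mul, Matrix.mul_one]
  rw [Matrix.mul_add, ← Matrix.mul_assoc, ← Matrix.mul_assoc, hcomm,
    Matrix.mul_assoc _ (s • 1 - _) _, mul_nonsing_inv _ hunit, Matrix.mul_one, ← map_ofReal_mul,
    Matrix.mul_smul, Matrix.sub_mul, ← map_ofReal_mul, hLJ, Matrix.smul_mul, Matrix.one_mul,
    Matrix.map_zero _ Complex.ofReal_zero, sub_zero, smul_smul, inv_mul_cancel₀ hs0, one_smul,
    ← Matrix.map_add _ Complex.ofReal_add, hTS, Matrix.map_one _ Complex.ofReal_zero Complex.ofReal_one]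

variable {p q : ℕ}

lemma transfer_neg_inv_mul (hn : 0 < n) (hd : ∀ i, 0 < d i) (hK : IsBalancedLaplacian K) {s : ℂ}
    (hs : 0 < s.re) (B : Matrix (Fin n) (Fin p) ℝ) (C : Matrix (Fin q) (Fin n) ℝ) :
    transfer (-((diagonal d)⁻¹ * K)) B C s =
      transfer (disagreement (diagonal d) K) (Splus (diagonal d) * (diagonal d * B))
        (C * (diagonal d)⁻¹ * S n) s +
      s⁻¹ • ((∑ i, d i)⁻¹ • (C * (allOnes n n * (diagonal d * B)))).map Complex.ofReal := by
  rw [transfer, inv_eq_right_inv (inv_smul_one_add_map hn hd hK hs), transfer, Matrix.mul_add,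
    Matrix.add_mul]
  congr 1
  · simp only [map_ofReal_mul, Matrix.mul_assoc]
  · rw [Matrix.mul_smul, Matrix.smul_mul, ← map_ofReal_mul, ← map_ofReal_mul, Matrix.mul_smul,
      Matrix.smul_mul]
    simp only [Matrix.mul_assoc]

lemma transfer_fromBlocks {a b : Type} [Fintype a] [Fintype b] [DecidableEq a] [DecidableEq b]
    {A₁ : Matrix a a ℝ} {A₂ : Matrix b b ℝ} (B₁ : Matrix a (Fin p) ℝ) (B₂ : Matrix b (Fin p) ℝ)
    (C₁ : Matrix (Fin q) a ℝ) (C₂ : Matrix (Fin q) b ℝ) {s : ℂ}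
    (h₁ : IsUnit (s • (1 : Matrix a a ℂ) - A₁.map Complex.ofReal).det)
    (h₂ : IsUnit (s • (1 : Matrix b b ℂ) - A₂.map Complex.ofReal).det) :
    transfer (fromBlocks A₁ 0 0 A₂) (fromRows B₁ B₂) (fromCols C₁ C₂) s =
      transfer A₁ B₁ C₁ s + transfer A₂ B₂ C₂ s := by
  have e : s • (1 : Matrix (a ⊕ b) (a ⊕ b) ℂ) - (fromBlocks A₁ 0 0 A₂).map Complex.ofReal =
      fromBlocks (s • 1 - A₁.map Complex.ofReal) 0 0 (s • 1 - A₂.map Complex.ofReal) := by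
    rw [← fromBlocks_one, fromBlocks_smul, fromBlocks_map, sub_eq_add_neg, fromBlocks_neg,
      fromBlocks_add]
    simp [sub_eq_add_neg]
  have hinv : (fromBlocks (s • 1 - A₁.map Complex.ofReal) 0 0 (s • 1 - A₂.map Complex.ofReal))⁻¹ =
      fromBlocks (s • 1 - A₁.map Complex.ofReal)⁻¹ 0 0 (s • 1 - A₂.map Complex.ofReal)⁻¹ := by
    apply inv_eq_right_inv
    rw [fromBlocks_multiply, mul_nonsing_inv _ h₁, mul_nonsing_inv _ h₂]
    simp
  have hC : (fromCols C₁ C₂).map Complex.ofReal =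
      fromCols (C₁.map Complex.ofReal) (C₂.map Complex.ofReal) := by
    ext i (j | j) <;> rfl
  have hB : (fromRows B₁ B₂).map Complex.ofReal =
      fromRows (B₁.map Complex.ofReal) (B₂.map Complex.ofReal) := by
    ext (i | i) j <;> rfl
  rw [transfer, e, hinv, hC, hB, fromCols_mul_fromBlocks, fromCols_mul_fromRows]
  simp [transfer]

lemma isLyapunovStable_fromBlocks {a b : Type} [Fintype a] [Fintype b]
    {A₁ : Matrix a a ℝ} {A₂ : Matrix b b ℝ} (h₁ : IsLyapunovStable A₁) (h₂ : IsLyapunovStable A₂) :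
    IsLyapunovStable (fromBlocks A₁ 0 0 A₂) := by
  obtain ⟨P₁, hP₁, h₁⟩ := h₁
  obtain ⟨P₂, hP₂, h₂⟩ := h₂
  have combine : ∀ (f : (a → ℝ) → ℝ) (g : (b → ℝ) → ℝ), f 0 = 0 → g 0 = 0 →
      (∀ x, x ≠ 0 → 0 < f x) → (∀ y, y ≠ 0 → 0 < g y) →
      ∀ x y, Sum.elim x y ≠ 0 → 0 < f x + g y := by
    intro f g f0 g0 hf hg x y hxy
    by_cases hx : x = 0
    · have hy := (sumElim_ne_zero hxy).resolve_left (not_not_intro hx)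
      rw [hx, f0, zero_add]
      exact hg y hy
    · by_cases hy : y = 0
      · rw [hy, g0, add_zero]
        exact hf x hx
      · exact add_pos (hf x hx) (hg y hy)
  refine ⟨fromBlocks P₁ 0 0 P₂, posDef_iff_real.2 ⟨?_, fun z hz => ?_⟩, fun z hz => ?_⟩
  · rw [fromBlocks_transpose, transpose_eq_of_posDef hP₁, transpose_eq_of_posDef hP₂]
    simp
  · obtain ⟨x, y, rfl⟩ : ∃ x y, z = Sum.elim x y := ⟨_, _, (Sum.elim_comp_inl_inr z).symm⟩
    have := combine (fun x => x ⬝ᵥ (P₁ *ᵥ x)) (fun y => y ⬝ᵥ (P₂ *ᵥ y)) (by simp) (by simp)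
      (posDef_iff_real.1 hP₁).2 (posDef_iff_real.1 hP₂).2 x y hz
    simpa [fromBlocks_mulVec, sumElim_dotProduct_sumElim] using this
  · obtain ⟨x, y, rfl⟩ : ∃ x y, z = Sum.elim x y := ⟨_, _, (Sum.elim_comp_inl_inr z).symm⟩
    have := combine (fun x => -(x ⬝ᵥ (P₁ *ᵥ (A₁ *ᵥ x)))) (fun y => -(y ⬝ᵥ (P₂ *ᵥ (A₂ *ᵥ y))))
      (by simp) (by simp) (fun x hx => neg_pos.2 (h₁ x hx)) (fun y hy => neg_pos.2 (h₂ y hy)) x y hz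
    rw [← neg_add, neg_pos] at this
    simpa [fromBlocks_mulVec, sumElim_dotProduct_sumElim] using this

end Reduction

/-! ### The strict norm bound and the error system -/

section Main
open Matrix

variable {n p q r : ℕ}

/-- The `H₂` norm bound of a stable system in terms of a strict Lyapunov inequality. -/
lemma h2NormSq_transfer_lt_iff {ι κ : Type} [Fintype ι] [DecidableEq ι] [Fintype κ]
    {A : Matrix ι ι ℝ} {B : Matrix ι (Fin p) ℝ} {C : Matrix (Fin q) ι ℝ} {E : Matrix ι κ ℝ}
    {γ : ℝ} (hA : IsLyapunovStable A) :
    h2NormSq (transfer A B C) < ENNReal.ofReal γ ↔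
    ∃ (X : Matrix ι ι ℝ) (δ : ℝ), X.PosDef ∧ 0 < δ ∧
      (-(A * X + X * Aᵀ + B * Bᵀ + δ • (E * Eᵀ))).PosDef ∧ (C * X * Cᵀ).trace < γ := by
  have hEE : (E * Eᵀ).PosSemidef := by simpa using posSemidef_self_mul_conjTranspose E
  -- Nonnegative traces make both sides fail for γ ≤ 0, where `ENNReal.ofReal` truncates to 0.
  have htr : ∀ {X : Matrix ι ι ℝ}, X.PosSemidef → 0 ≤ (C * X * Cᵀ).trace := fun {X} hX => by
    have := (hX.mul_mul_conjTranspose_same C).trace_nonneg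
    simpa using this
  constructor
  · intro h
    have hBB := posSemidef_mul_transpose B
    -- X₀ answers to B Bᵀ and X₁ to E Eᵀ + 1. For X₀ + ε X₁ with δ = ε, the left side of the
    -- inequality is exactly -ε·1.
    obtain ⟨X₀, hX₀, hL₀⟩ := exists_lyapunov_solution hA (posSemidef_iff_real.1 hBB).1
    have hQ : (E * Eᵀ + 1).PosDef := PosDef.posSemidef_add hEE PosDef.one
    obtain ⟨X₁, hX₁, hL₁⟩ := exists_lyapunov_solution hA (posDef_iff_real.1 hQ).1
    have hp₀ := posSemidef_of_lyapunov hA hX₀ hL₀ hBB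
    have hp₁ := posDef_of_lyapunov hA hX₁ hL₁ hQ
    have ht₀ := htr hp₀
    have ht₁ := htr hp₁.posSemidef
    have hlt : (C * X₀ * Cᵀ).trace < γ :=
      (ENNReal.ofReal_lt_ofReal_iff_of_nonneg ht₀).1
        ((le_h2NormSq_transfer hA hX₀ hL₀).trans_lt h)
    have hε : 0 < (γ - (C * X₀ * Cᵀ).trace) / ((C * X₁ * Cᵀ).trace + 1) :=
      div_pos (by linarith) (by linarith)
    obtain ⟨ε, hε, hεlt⟩ : ∃ ε : ℝ, 0 < ε ∧
        (C * X₀ * Cᵀ).trace + ε * (C * X₁ * Cᵀ).trace < γ := by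
      refine ⟨_, hε, ?_⟩
      rw [div_mul_eq_mul_div, ← lt_sub_iff_add_lt', div_lt_iff₀ (by linarith)]
      nlinarith
    refine ⟨X₀ + ε • X₁, ε, PosDef.posSemidef_add hp₀ (hp₁.smul hε), hε, ?_, ?_⟩
    · have e : -(A * (X₀ + ε • X₁) + (X₀ + ε • X₁) * Aᵀ + B * Bᵀ + ε • (E * Eᵀ)) =
          ε • (1 : Matrix ι ι ℝ) := by
        have e1 : A * (X₀ + ε • X₁) + (X₀ + ε • X₁) * Aᵀ =
            (A * X₀ + X₀ * Aᵀ) + ε • (A * X₁ + X₁ * Aᵀ) := by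
          simp only [Matrix.mul_add, Matrix.add_mul, Matrix.mul_smul, Matrix.smul_mul, smul_add]
          abel
        rw [e1, hL₀, hL₁, smul_neg, smul_add]
        abel
      rw [e]
      exact PosDef.one.smul hε
    · simpa [Matrix.mul_add, Matrix.add_mul] using hεlt
  · rintro ⟨X, δ, hX, hδ, hL, htX⟩
    have ht := htr hX.posSemidef
    refine (h2NormSq_transfer_le hA hX.posSemidef ?_).trans_lt
      ((ENNReal.ofReal_lt_ofReal_iff_of_nonneg ht).2 htX)
    have := hL.posSemidef.add (hEE.smul hδ.le)
    convert this using 1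
    abel

lemma Mhat_diagonal (c : Fin n → Fin r) (μ : Fin n → ℝ) :
    Mhat c (diagonal μ) = diagonal fun k => ∑ i, if c i = k then μ i else 0 := by
  ext k l
  rw [Mhat, Matrix.mul_apply]
  simp only [mul_diagonal, transpose_apply, Pi, of_apply, diagonal_apply]
  by_cases h : k = l
  · subst h
    rw [if_pos rfl]
    refine Finset.sum_congr rfl fun i _ => ?_
    by_cases hi : c i = k <;> simp [hi]
  · rw [if_neg h]
    refine Finset.sum_eq_zero fun i _ => ?_
    by_cases hi : c i = k
    · have : c i ≠ l := fun h' => h (hi.symm.trans h')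
      simp [this]
    · simp [hi]

lemma clusterWeight_pos {c : Fin n → Fin r} (hc : Function.Surjective c) {μ : Fin n → ℝ}
    (hμ : ∀ i, 0 < μ i) (k : Fin r) : 0 < ∑ i, if c i = k then μ i else 0 := by
  obtain ⟨i, hi⟩ := hc k
  refine Finset.sum_pos' (fun j _ => ?_) ⟨i, Finset.mem_univ i, ?_⟩
  · split_ifs
    exacts [(hμ j).le, le_rfl]
  · rw [if_pos hi]
    exact hμ i

lemma sum_clusterWeight (c : Fin n → Fin r) (μ : Fin n → ℝ) :
    ∑ k, (∑ i, if c i = k then μ i else 0) = ∑ i, μ i := by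
  rw [Finset.sum_comm]
  simp

/-- Each vertex lies in exactly one cluster, so Π 1 = 1; this makes the average modes agree. -/
lemma Pi_mul_allOnes_mul (c : Fin n → Fin r) :
    Pi c * allOnes r r * (Pi c)ᵀ = allOnes n n := by
  ext i j
  simp [Matrix.mul_apply, Pi, allOnes]

/-- The state matrix of the error system on the disagreement space. -/
def Network.errorMatrix (N : Network n p q) (c : Fin n → Fin r) (M : Matrix (Fin n) (Fin n) ℝ)
    (W : Matrix (Edge (N.quotAdj c)) (Edge (N.quotAdj c)) ℝ) :
    Matrix (Fin (n - 1) ⊕ Fin (r - 1)) (Fin (n - 1) ⊕ Fin (r - 1)) ℝ :=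
  fromBlocks (disagreement M (N.Lb M)) 0 0 (disagreement (Mhat c M) (N.LbHat c W))

lemma Network.Abar_add_E_mul_Abarr (N : Network n p q) (c : Fin n → Fin r)
    (M : Matrix (Fin n) (Fin n) ℝ) (W : Matrix (Edge (N.quotAdj c)) (Edge (N.quotAdj c)) ℝ) :
    N.Abar M + E n r * N.Abarr c M W = N.errorMatrix c M W := by
  rw [Network.Abar, E, Network.Abarr, fromBlocks_multiply, fromBlocks_add, Network.errorMatrix,
    disagreement, disagreement, Network.LbHat]
  simp

variable (N : Network n p q) {c : Fin n → Fin r} {μ : Fin n → ℝ}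
  {W : Matrix (Edge (N.quotAdj c)) (Edge (N.quotAdj c)) ℝ}

lemma Network.isLyapunovStable_errorMatrix (hc : Function.Surjective c) (hμ : ∀ i, 0 < μ i)
    (hbal : IsBalanced (diagonal μ * N.A)) (hW : W ∈ N.weights c) :
    IsLyapunovStable (N.errorMatrix c (diagonal μ) W) := by
  have hr : 0 < r := Nat.zero_lt_of_lt (c ⟨0, N.nonempty⟩).2
  rw [Network.errorMatrix, Mhat_diagonal]
  exact isLyapunovStable_fromBlocks
    (isLyapunovStable_disagreement N.nonempty hμ (N.isBalancedLaplacian_Lb hμ hbal))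
    (isLyapunovStable_disagreement hr (clusterWeight_pos hc hμ) (N.isBalancedLaplacian_LbHat hc hW))

/-- The average modes of the network and of its reduced model cancel in the error system. -/
lemma Network.errorTransfer_eq (hc : Function.Surjective c) (hμ : ∀ i, 0 < μ i)
    (hbal : IsBalanced (diagonal μ * N.A)) (hW : W ∈ N.weights c) {s : ℂ} (hs : 0 < s.re) :
    N.errorTransfer c (diagonal μ) W s =
      transfer (N.errorMatrix c (diagonal μ) W) (N.Be c (diagonal μ)) (N.Ce c (diagonal μ)) s := by
  have hr : 0 < r := Nat.zero_lt_of_lt (c ⟨0, N.nonempty⟩).2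
  have hK := N.isBalancedLaplacian_Lb hμ hbal
  have hK' := N.isBalancedLaplacian_LbHat hc hW
  have hν := clusterWeight_pos hc hμ
  have hL : N.L = (diagonal μ)⁻¹ * N.Lb (diagonal μ) := by
    rw [Network.Lb, ← Matrix.mul_assoc, nonsing_inv_mul _ (isUnit_det_diagonal_of_pos hμ),
      Matrix.one_mul]
  have hF : Mhat c (diagonal μ) * N.FHat c (diagonal μ) = N.FbHat c (diagonal μ) := by
    rw [Network.FHat, ← Matrix.mul_assoc, Mhat_diagonal,
      mul_nonsing_inv _ (isUnit_det_diagonal_of_pos hν), Matrix.one_mul]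
  have hblocks : -fromBlocks N.L 0 0 (N.LHat c (diagonal μ) W) =
      fromBlocks (-((diagonal μ)⁻¹ * N.Lb (diagonal μ))) 0 0
        (-((Mhat c (diagonal μ))⁻¹ * N.LbHat c W)) := by
    rw [fromBlocks_neg, ← hL, Network.LHat]
    simp
  have hav : N.HHat c * (allOnes r r * N.FbHat c (diagonal μ)) =
      N.H * (allOnes n n * (diagonal μ * N.F)) := by
    rw [← Pi_mul_allOnes_mul c, Network.HHat, Network.FbHat, Network.Fb]
    simp only [Matrix.mul_assoc]
  have h₁ := isUnit_det_of_right_inverse (inv_smul_one_add_map N.nonempty hμ hK hs)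
  have h₂ := isUnit_det_of_right_inverse (inv_smul_one_add_map hr hν hK' hs)
  rw [← Mhat_diagonal] at h₂
  have t₂ := transfer_neg_inv_mul hr hν hK' hs (N.FHat c (diagonal μ)) (-N.HHat c)
  rw [← Mhat_diagonal, hF, sum_clusterWeight] at t₂
  have hst₁ := (isLyapunovStable_disagreement N.nonempty hμ hK).isUnit_det hs.le
  have hst₂ := (isLyapunovStable_disagreement hr hν hK').isUnit_det hs.le
  rw [← Mhat_diagonal] at hst₂
  rw [Network.errorTransfer, hblocks, transfer_fromBlocks _ _ _ _ h₁ h₂,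
    transfer_neg_inv_mul N.nonempty hμ hK hs, t₂, Network.errorMatrix, Network.Be, Network.Ce,
    transfer_fromBlocks _ _ _ _ hst₁ hst₂, Matrix.neg_mul, Matrix.neg_mul,
    Matrix.neg_mul, hav, smul_neg,
    Matrix.map_neg _ Complex.ofReal_neg, smul_neg, Network.Fb]
  abel

/-- The transfer functions are compared only for Re s > 0, which is all the norm sees. -/
lemma Network.h2NormSq_errorTransfer (hc : Function.Surjective c) (hμ : ∀ i, 0 < μ i)
    (hbal : IsBalanced (diagonal μ * N.A)) (hW : W ∈ N.weights c) :
    h2NormSq (N.errorTransfer c (diagonal μ) W) =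
      h2NormSq (transfer (N.errorMatrix c (diagonal μ) W) (N.Be c (diagonal μ))
        (N.Ce c (diagonal μ))) := by
  refine iSup_congr fun σ => iSup_congr fun hσ => ?_
  congr 1
  refine MeasureTheory.lintegral_congr fun ω => ?_
  rw [N.errorTransfer_eq hc hμ hbal hW (by simpa using hσ)]

end Main

end NetRed

end

theorem theorem1 {n p q r : ℕ} (N : NetRed.Network n p q)
    -- the clustering into `r` nonempty clusters
    (c : Fin n → Fin r) (hc : Function.Surjective c)
    -- the diagonal matrix `M = Diag μ` of the balanced representation
    (μ : Fin n → ℝ) (hμ : ∀ i, 0 < μ i)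
    (M : Matrix (Fin n) (Fin n) ℝ) (hM : M = Matrix.diagonal μ)
    (hbal : NetRed.IsBalanced (M * N.A))
    (γ : ℝ) :
    (∃ W ∈ N.weights c, NetRed.h2NormSq (N.errorTransfer c M W) < ENNReal.ofReal γ) ↔
    ∃ (Q : Matrix (Fin (n - 1) ⊕ Fin (r - 1)) (Fin (n - 1) ⊕ Fin (r - 1)) ℝ)
      (R : Matrix (Fin q) (Fin q) ℝ)
      (W : Matrix (NetRed.Edge (N.quotAdj c)) (NetRed.Edge (N.quotAdj c)) ℝ) (δ : ℝ),
      Q.PosDef ∧ R.PosDef ∧ W ∈ N.weights c ∧ 0 < δ ∧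
      (-(NetRed.block3
            (Q * N.Abar M + (N.Abar M).transpose * Q) (Q * N.Be c M) (Q * NetRed.E n r)
            ((N.Be c M).transpose * Q) (-(δ • (1 : Matrix (Fin p) (Fin p) ℝ))) 0
            ((NetRed.E n r).transpose * Q) 0 0
          + NetRed.block3
            (-((N.Abarr c M W).transpose * N.Abarr c M W)) 0 (N.Abarr c M W).transpose
            0 0 0
            (N.Abarr c M W) 0 (-1))).PosDef ∧
      (Matrix.fromBlocks Q (δ • (N.Ce c M).transpose) (δ • N.Ce c M) R).PosDef ∧
      R.trace < δ * γ := by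
  subst hM
  constructor
  · rintro ⟨W, hW, h⟩
    -- The norm does not involve E, so E can be chosen freely here; the E of the matrix inequality
    -- is the one needed.
    rw [N.h2NormSq_errorTransfer hc hμ hbal hW, NetRed.h2NormSq_transfer_lt_iff
      (E := NetRed.E n r) (N.isLyapunovStable_errorMatrix hc hμ hbal hW),
      ← N.Abar_add_E_mul_Abarr] at h
    obtain ⟨Q, R, δ, hQ, hR, hδ, h1, h2, h3⟩ := NetRed.exists_lmi_iff_exists_lyapunov.2 h
    exact ⟨Q, R, W, δ, hQ, hR, hW, hδ, h1, h2, h3⟩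
  · rintro ⟨Q, R, W, δ, hQ, hR, hW, hδ, h1, h2, h3⟩
    refine ⟨W, hW, ?_⟩
    rw [N.h2NormSq_errorTransfer hc hμ hbal hW, NetRed.h2NormSq_transfer_lt_iff
      (E := NetRed.E n r) (N.isLyapunovStable_errorMatrix hc hμ hbal hW),
      ← N.Abar_add_E_mul_Abarr]
    exact NetRed.exists_lmi_iff_exists_lyapunov.1 ⟨Q, R, δ, hQ, hR, hδ, h1, h2, h3⟩
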